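/- Throughout, the regular $n$-simplex is represented by its $n$ vertices, the standard basis vectors $\mathbf e_1,\dots,\mathbf e_n$ of $\mathbb R^n$ (the terminals). A Steiner tree of a finite set $P\subset\mathbb R^n$ of terminals consists of a finite set $S\subset\mathbb R^n\setminus P$ of Steiner points and a spanning tree on the vertex set $P\cup S$; its cost is the sum of the Euclidean lengths of its edges. It is optimal if it has minimum cost among all Steiner trees of $P$ and has no Steiner point that merely subdivides a segment (i.e. no Steiner point of degree two lying on the segment between its two neighbours). It is full if $|S|=|P|-2$. It is candidate-optimal if any two distinct edges with a common endpoint include an angle of at least $120^\circ$ and every Steiner point has degree exactly $3$. The Fermat point of a triangle is the point which minimizes the sum of the distances to the three corners, provided that this point is none of the corners (otherwise the triangle has no Fermat point). For $\mathbf x\in\mathbb R^n$ let $\mathbf x'=(\tfrac{x_1}2,\tfrac{x_1}2,\dots,\tfrac{x_n}2,\tfrac{x_n}2)\in\mathbb R^{2n}$ be its split. The doubling procedure turns a Steiner tree $T$ of the regular $n$-simplex with Steiner points $S$, in which every terminal $\mathbf e_i$ is a leaf adjacent to a Steiner point $\mathbf s_i$, into a Steiner tree $T'$ of the regular $2n$-simplex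 as follows: for each $1\le i\le n$ let $\mathbf x_i$ be the Fermat point of the triangle $\mathbf e_{2i-1}\mathbf e_{2i}\mathbf s_i'$ in $\mathbb R^{2n}$ (the procedure requires that it exists); the Steiner points of $T'$ are the points $\mathbf s'$ with $\mathbf s\in S$ and the points $\mathbf x_1,\dots,\mathbf x_n$; the edges of $T'$ are $(\mathbf r',\mathbf s')$ for all $\mathbf r,\mathbf s\in S$ adjacent in $T$, and $(\mathbf e_{2i-1},\mathbf x_i)$, $(\mathbf e_{2i},\mathbf x_i)$, $(\mathbf x_i,\mathbf s_i')$ for $1\le i\le n$. Corollary. Let $d\ge 3$, $k\ge 0$, and let $T$ be an optimal Steiner tree of the regular $d$-simplex. Then, starting from $T$, the doubling procedure can be carried out $k$ times in succession, its result $T'$ is uniquely determined by $T$ and $k$, and $T'$ is a full, candidate-optimal Steiner tree of the regular $2^k d$-simplex. -/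

import Mathlib

/-- A Steiner tree of a set `P` of terminals in a metric space: finitely many additional points
(the Steiner points, not themselves terminals) together with a spanning tree of the set of all
terminals and Steiner points. The tree is recorded as a graph on the whole space all of whose
edges join terminals or Steiner points. -/
@[ext]
structure SteinerTree {E : Type*} [MetricSpace E] (P : Set E) where
  /-- the Steiner points -/
  steiner : Set E
  /-- the edges of the tree -/
  graph : SimpleGraph E
  finite_verts : (P ∪ steiner).Finite
  disjoint : Disjoint P steiner
  mem_of_adj : ∀ u v, graph.Adj u v → u ∈ P ∪ steiner
  isTree : (graph.induce (P ∪ steiner)).IsTree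

namespace SteinerTree

variable {E : Type*} [MetricSpace E] {P : Set E}

theorem finite_edgeSet (T : SteinerTree P) : T.graph.edgeSet.Finite := by
  refine ((T.finite_verts.prod T.finite_verts).image (fun p : E × E => s(p.1, p.2))).subset ?_
  intro e
  induction e with
  | h u v =>
    intro he
    have h : T.graph.Adj u v := he
    exact ⟨(u, v), ⟨T.mem_of_adj u v h, T.mem_of_adj v u h.symm⟩, rfl⟩

/-- The cost of a Steiner tree: the sum of the distances between the endpoints of its edges. -/
noncomputable def length (T : SteinerTree P) : ℝ :=
  ∑ e ∈ T.finite_edgeSet.toFinset, Sym2.lift ⟨fun u v : E => dist u v, dist_comm⟩ e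

/-- A Steiner tree of `P` with `|P| - 2` Steiner points. -/
def IsFull (T : SteinerTree P) : Prop :=
  T.steiner.ncard + 2 = P.ncard

end SteinerTree

section Euclidean

variable {E : Type*} [NormedAddCommGroup E] [InnerProductSpace ℝ E]

/-- An optimal Steiner tree: a Steiner tree of minimum cost, without trivial Steiner points,
i.e. without Steiner points that merely subdivide a segment. -/
def SteinerTree.IsOptimal {P : Set E} (T : SteinerTree P) : Prop :=
  (∀ T' : SteinerTree P, T.length ≤ T'.length) ∧
    ∀ s ∈ T.steiner, ¬ ∃ u v : E, u ≠ v ∧ T.graph.neighborSet s = {u, v} ∧ s ∈ segment ℝ u v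

/-- Any two edges with a common endpoint include an angle of at least 120 degrees, and every
Steiner point has degree exactly three. -/
def SteinerTree.IsCandidateOptimal {P : Set E} (T : SteinerTree P) : Prop :=
  (∀ u v w : E, T.graph.Adj v u → T.graph.Adj v w → u ≠ w →
      2 * Real.pi / 3 ≤ EuclideanGeometry.angle u v w) ∧
    ∀ s ∈ T.steiner, (T.graph.neighborSet s).ncard = 3

/-- `x` is the Fermat point of the triangle `a b c`, i.e. the Steiner point of the optimal
Steiner tree of `a`, `b`, `c`: it is none of the corners and it minimizes the sum of
the distances to them. A triangle has such a point only if all its angles are less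
than 120 degrees. -/
def IsFermatPoint (a b c x : E) : Prop :=
  x ≠ a ∧ x ≠ b ∧ x ≠ c ∧ ∀ y : E, dist x a + dist x b + dist x c ≤ dist y a + dist y b + dist y c

end Euclidean

/-- The `i`-th standard basis vector of `ℝⁿ`. -/
noncomputable def basisVec {n : ℕ} (i : Fin n) : EuclideanSpace ℝ (Fin n) :=
  EuclideanSpace.single i 1

/-- The vertices of the regular `n`-simplex: the `n` standard basis vectors of `ℝⁿ`. -/
def simplexVertices (n : ℕ) : Set (EuclideanSpace ℝ (Fin n)) :=
  Set.range basisVec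

/-- Steiner trees of the regular `n`-simplex. -/
abbrev SimplexSteinerTree (n : ℕ) : Type :=
  SteinerTree (simplexVertices n)

/-- The split `(x₁/2, x₁/2, …, xₙ/2, xₙ/2)` of a point `x` of `ℝⁿ`. -/
noncomputable def splitPoint {n : ℕ} (x : EuclideanSpace ℝ (Fin n)) :
    EuclideanSpace ℝ (Fin (2 * n)) :=
  WithLp.toLp 2 fun j => x ⟨j.val / 2, by omega⟩ / 2

/-- The first of the two indices in `Fin (2 * n)` that replace the index `i`. -/
def leftIdx {n : ℕ} (i : Fin n) : Fin (2 * n) := ⟨2 * i.val, by omega⟩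

/-- The second of the two indices in `Fin (2 * n)` that replace the index `i`. -/
def rightIdx {n : ℕ} (i : Fin n) : Fin (2 * n) := ⟨2 * i.val + 1, by omega⟩

/-- `T'` is obtained from `T` by the doubling procedure. Each terminal `eᵢ` of `T` has to be a leaf
attached to a Steiner point `s i`, and the triangle formed by the two terminals that replace `eᵢ`
and the split of `s i` has to have a Fermat point `x i`. The Steiner points of `T'` are the splits
of those of `T` and the points `x i`; the edges of `T'` are the splits of the edges of `T` between
Steiner points and, for each `i`, the three edges from `x i` to the corners of the triangle. -/
def IsDoubling {n : ℕ} (T : SimplexSteinerTree n) (T' : SimplexSteinerTree (2 * n)) : Prop :=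
  ∃ (s : Fin n → EuclideanSpace ℝ (Fin n)) (x : Fin n → EuclideanSpace ℝ (Fin (2 * n))),
    (∀ i, s i ∈ T.steiner ∧ T.graph.neighborSet (basisVec i) = {s i}) ∧
    (∀ i, IsFermatPoint (basisVec (leftIdx i)) (basisVec (rightIdx i)) (splitPoint (s i)) (x i)) ∧
    T'.steiner = splitPoint '' T.steiner ∪ Set.range x ∧
    T'.graph.edgeSet =
      {e | ∃ r ∈ T.steiner, ∃ t ∈ T.steiner, T.graph.Adj r t ∧
          e = s(splitPoint r, splitPoint t)} ∪
      {e | ∃ i, e = s(basisVec (leftIdx i), x i) ∨ e = s(basisVec (rightIdx i), x i) ∨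
          e = s(x i, splitPoint (s i))}

/-- `IteratedDoubling T k n T'`: the tree `T'` of the regular `n`-simplex is obtained from `T` by
performing the doubling procedure `k` times. -/
inductive IteratedDoubling {d : ℕ} (T : SimplexSteinerTree d) :
    ℕ → (n : ℕ) → SimplexSteinerTree n → Prop
  | zero : IteratedDoubling T 0 d T
  | succ {k n : ℕ} {T₁ : SimplexSteinerTree n} {T₂ : SimplexSteinerTree (2 * n)} :
      IteratedDoubling T k n T₁ → IsDoubling T₁ T₂ → IteratedDoubling T (k + 1) (2 * n) T₂

/-! Candidate-optimality on at least three terminals is an invariant of doubling. An optimal tree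
has it by local surgery: replacing two edges at a vertex by a tripod forces angles of at least 120°
(`dist_add_dist_le`, `inner_direction_le_of_forall_dist_le`), which bounds degrees by 3. Contracting
an edge at a Steiner point of degree 1 would save length, and at degree 2 it shows that the point
subdivides a segment.

For a candidate-optimal tree of the simplex, the three unit directions at a Steiner point sum to
zero. This gives a maximum principle (`subset_convexHull_of_steiner`): all vertices lie in the
simplex, and each branch at a Steiner point s lies in the hull of s and the terminals of the branch.
Since the simplex has no obtuse angle at its vertices, terminals are leaves; counting degrees then
gives fullness.

The crux is the bound |e_i - s_i| > 1/√3 (`one_third_lt_norm_sq`). The two branches at s_i away from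
e_i carry disjoint sets of terminals, so their directions are V - y s_i and W - z s_i with e_i, V, W
pairwise orthogonal. The norms of the three directions, summing to zero, then exclude shorter edges.

Splitting is a similarity of ratio 1/√2 that sends e_i to the midpoint of the two new terminals.
Their Fermat point with s_i' is the split of the point at distance 1/√3 from e_i towards s_i; the
bound says that this point lies strictly before s_i. Thus the doubled tree is a similar copy of the
tree with its leaf edges shortened, plus two new leaves at each shortened end. Angles are inherited
or equal to 120°, the Fermat points are unique, and the induction on k goes through. -/

/-! ### Reachability in graphs whose edges live on a vertex set. -/

namespace SimpleGraph

variable {V : Type*} {G : SimpleGraph V} {s : Set V}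

theorem Reachable.induce_of_forall_adj_mem (h : ∀ u v, G.Adj u v → u ∈ s) {x y : V}
    (hxy : G.Reachable x y) (hx : x ∈ s) (hy : y ∈ s) :
    (G.induce s).Reachable ⟨x, hx⟩ ⟨y, hy⟩ := by
  obtain ⟨p⟩ := hxy
  induction p with
  | nil => exact Reachable.refl _
  | @cons a b c hab p ih =>
    have hb : b ∈ s := h b a hab.symm
    have hadj : (G.induce s).Adj ⟨a, hx⟩ ⟨b, hb⟩ := hab
    exact hadj.reachable.trans (ih hb hy)

/-- A set closed under adjacency is closed under reachability. -/
theorem Reachable.mem_of_forall_adj_mem (h : ∀ u v, G.Adj u v → u ∈ s → v ∈ s) {x y : V}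
    (hxy : G.Reachable x y) (hx : x ∈ s) : y ∈ s := by
  obtain ⟨p⟩ := hxy
  induction p with
  | nil => exact hx
  | cons hab p ih => exact ih (h _ _ hab hx)

/-- Reachability is transported along a map that sends edges to reachable pairs. -/
theorem Reachable.of_forall_adj {W : Type*} {H : SimpleGraph W} (f : V → W)
    (h : ∀ u v, G.Adj u v → H.Reachable (f u) (f v)) {x y : V} (hxy : G.Reachable x y) :
    H.Reachable (f x) (f y) := by
  obtain ⟨p⟩ := hxy
  induction p with
  | nil => exact Reachable.refl _
  | cons hab p ih => exact (h _ _ hab).trans ih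

theorem connected_induce_of_forall_reachable (hs : s.Nonempty)
    (h : ∀ u v, G.Adj u v → u ∈ s) (hr : ∀ x ∈ s, ∀ y ∈ s, G.Reachable x y) :
    (G.induce s).Connected := by
  have : Nonempty s := hs.to_subtype
  exact Connected.mk fun x y => (hr x x.2 y y.2).induce_of_forall_adj_mem h x.2 y.2

end SimpleGraph

/-- The length of an edge. -/
noncomputable def edgeLength {E : Type*} [MetricSpace E] : Sym2 E → ℝ :=
  Sym2.lift ⟨fun u v : E => dist u v, dist_comm⟩

@[simp]
theorem edgeLength_mk {E : Type*} [MetricSpace E] (u v : E) : edgeLength s(u, v) = dist u v :=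
  rfl

theorem edgeLength_nonneg {E : Type*} [MetricSpace E] (e : Sym2 E) : 0 ≤ edgeLength e := by
  induction e with
  | h u v => exact dist_nonneg

/-! ### Surgery on Steiner trees of minimum cost. -/

namespace SteinerTree

variable {E : Type*} [MetricSpace E] {P : Set E} (T : SteinerTree P)

theorem length_eq : T.length = ∑ e ∈ T.finite_edgeSet.toFinset, edgeLength e :=
  rfl

variable {T}

theorem mem_of_adj_right {u v : E} (h : T.graph.Adj u v) : v ∈ P ∪ T.steiner :=
  T.mem_of_adj v u h.symm

theorem notMem_of_mem_steiner {x : E} (hx : x ∈ T.steiner) : x ∉ P :=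
  fun h => Set.disjoint_left.1 T.disjoint h hx

theorem reachable {x y : E} (hx : x ∈ P ∪ T.steiner) (hy : y ∈ P ∪ T.steiner) :
    T.graph.Reachable x y :=
  (T.isTree.connected ⟨x, hx⟩ ⟨y, hy⟩).map
    (⟨Subtype.val, fun h => h⟩ : T.graph.induce (P ∪ T.steiner) →g T.graph)

/-- Different neighbors of a vertex are separated by the removal of that vertex. -/
theorem not_reachable_deleteIncidenceSet {s a b : E} (ha : T.graph.Adj s a)
    (hb : T.graph.Adj s b) (hab : a ≠ b) :
    ¬ (T.graph.deleteIncidenceSet s).Reachable a b := by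
  intro h
  set V := P ∪ T.steiner with hV
  have hs : s ∈ V := T.mem_of_adj _ _ ha
  have ha' : a ∈ V := mem_of_adj_right ha
  have hbr := (SimpleGraph.isAcyclic_iff_forall_adj_isBridge.1 T.isTree.isAcyclic)
    (show (T.graph.induce V).Adj ⟨s, hs⟩ ⟨a, ha'⟩ from ha)
  -- A connection of a and b off s, extended by the edge sb, would bypass the edge sa, which is a
  -- bridge.
  have key : (T.graph.deleteEdges {s(s, a)}).Reachable s a := by
    have h1 : (T.graph.deleteEdges {s(s, a)}).Adj s b := by
      rw [SimpleGraph.deleteEdges_adj]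
      refine ⟨hb, fun h => hab ?_⟩
      simp only [Set.mem_singleton_iff, Sym2.eq_iff] at h
      rcases h with h | h
      · exact h.2.symm
      · exact (ha.ne h.1).elim
    refine h1.reachable.trans (h.symm.mono ?_)
    intro x y hxy
    rw [SimpleGraph.deleteIncidenceSet_adj] at hxy
    rw [SimpleGraph.deleteEdges_adj]
    refine ⟨hxy.1, fun h => ?_⟩
    simp only [Set.mem_singleton_iff, Sym2.eq_iff] at h
    rcases h with h | h
    · exact hxy.2.1 h.1
    · exact hxy.2.2 h.2
  rw [SimpleGraph.isBridge_iff] at hbr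
  apply hbr
  refine (key.induce_of_forall_adj_mem (s := V)
    (fun u v huv => T.mem_of_adj u v (SimpleGraph.deleteEdges_le _ huv)) hs ha').mono ?_
  intro x y hxy
  have h2 := SimpleGraph.deleteEdges_adj.1 (show (T.graph.deleteEdges {s(s, a)}).Adj x y from hxy)
  refine SimpleGraph.deleteEdges_adj.2 ⟨h2.1, fun h => h2.2 ?_⟩
  simp only [Set.mem_singleton_iff, Sym2.eq_iff, Subtype.ext_iff] at h ⊢
  exact h

/-- A connected graph through the terminals contains a Steiner tree. -/
theorem exists_length_le (hP : P.Nonempty) {V : Set E} (hV : V.Finite) (hPV : P ⊆ V)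
    (F : Finset (Sym2 E)) (hF : ∀ u v, s(u, v) ∈ F → u ∈ V)
    (hconn : ∀ x ∈ V, ∀ y ∈ V, (SimpleGraph.fromEdgeSet (F : Set (Sym2 E))).Reachable x y) :
    ∃ T' : SteinerTree P, T'.length ≤ ∑ e ∈ F, edgeLength e := by
  have hc : ((SimpleGraph.fromEdgeSet (F : Set (Sym2 E))).induce V).Connected :=
    SimpleGraph.connected_induce_of_forall_reachable (hP.mono hPV)
      (fun u v huv => hF u v (by simpa using ((SimpleGraph.fromEdgeSet_adj _).1 huv).1)) hconn
  obtain ⟨T₀, hle, hT₀⟩ := hc.exists_isTree_le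
  have hset : P ∪ V \ P = V := Set.union_sdiff_cancel hPV
  have hadj : ∀ u v, T₀.spanningCoe.Adj u v →
      u ∈ V ∧ (SimpleGraph.fromEdgeSet (F : Set (Sym2 E))).Adj u v := by
    intro u v huv
    rw [SimpleGraph.map_adj] at huv
    obtain ⟨a, b, hab, rfl, rfl⟩ := huv
    exact ⟨a.2, hle hab⟩
  let T' : SteinerTree P :=
    { steiner := V \ P
      graph := T₀.spanningCoe
      finite_verts := by rw [hset]; exact hV
      disjoint := Set.disjoint_sdiff_right
      mem_of_adj := fun u v huv => by rw [hset]; exact (hadj u v huv).1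
      isTree := by
        rw [hset, SimpleGraph.induce_spanningCoe]
        exact hT₀ }
  refine ⟨T', ?_⟩
  rw [length_eq]
  refine Finset.sum_le_sum_of_subset_of_nonneg ?_ fun e _ _ => edgeLength_nonneg e
  intro e he
  induction e with
  | h u v =>
    have h1 : T'.graph.Adj u v := by simpa using he
    simpa using ((SimpleGraph.fromEdgeSet_adj _).1 (hadj u v h1).2).1

/-- Replacing two edges of a shortest Steiner tree by a tripod does not decrease the cost. -/
theorem dist_add_dist_le (hmin : ∀ T' : SteinerTree P, T.length ≤ T'.length) (hP : P.Nonempty)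
    {u v w : E} (hu : T.graph.Adj v u) (hw : T.graph.Adj v w) (huw : u ≠ w) (x : E) :
    dist v u + dist v w ≤ dist x v + dist x u + dist x w := by
  classical
  set D := T.finite_edgeSet.toFinset with hD
  have hmemD : ∀ a b, s(a, b) ∈ D ↔ T.graph.Adj a b := by simp [hD]
  set R : Finset (Sym2 E) := {s(v, u), s(v, w)} with hR
  set N : Finset (Sym2 E) := {s(x, v), s(x, u), s(x, w)} with hN
  have hreach : ∀ a b, s(a, b) ∈ (D \ R) ∪ N →
      (SimpleGraph.fromEdgeSet (((D \ R) ∪ N : Finset (Sym2 E)) : Set (Sym2 E))).Reachable a b := by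
    intro a b h
    by_cases hab : a = b
    · subst hab; exact SimpleGraph.Reachable.refl _
    · exact SimpleGraph.Adj.reachable ((SimpleGraph.fromEdgeSet_adj _).2 ⟨Finset.mem_coe.2 h, hab⟩)
  have hxv := hreach x v (by simp [hN])
  have hxu := hreach x u (by simp [hN])
  have hxw := hreach x w (by simp [hN])
  have hadj : ∀ a b, T.graph.Adj a b →
      (SimpleGraph.fromEdgeSet (((D \ R) ∪ N : Finset (Sym2 E)) : Set (Sym2 E))).Reachable a b := by
    intro a b hab
    by_cases hab' : s(a, b) ∈ R
    · simp only [hR, Finset.mem_insert, Finset.mem_singleton, Sym2.eq_iff] at hab'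
      rcases hab' with (⟨rfl, rfl⟩ | ⟨rfl, rfl⟩) | (⟨rfl, rfl⟩ | ⟨rfl, rfl⟩)
      · exact hxv.symm.trans hxu
      · exact hxu.symm.trans hxv
      · exact hxv.symm.trans hxw
      · exact hxw.symm.trans hxv
    · exact hreach a b (Finset.mem_union_left _ (Finset.mem_sdiff.2 ⟨(hmemD a b).2 hab, hab'⟩))
  have hv : v ∈ P ∪ T.steiner := T.mem_of_adj _ _ hu
  have hvV : ∀ y ∈ insert x (P ∪ T.steiner), (SimpleGraph.fromEdgeSet
      (((D \ R) ∪ N : Finset (Sym2 E)) : Set (Sym2 E))).Reachable v y := by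
    rintro y (rfl | hy)
    · exact hxv.symm
    · exact (T.reachable hv hy).of_forall_adj id hadj
  obtain ⟨T', hT'⟩ := exists_length_le hP (V := insert x (P ∪ T.steiner))
    (T.finite_verts.insert x) (fun y hy => Or.inr (Or.inl hy)) ((D \ R) ∪ N) (by
      intro a b h
      rcases Finset.mem_union.1 h with h | h
      · exact Or.inr (T.mem_of_adj a b ((hmemD a b).1 (Finset.mem_sdiff.1 h).1))
      · simp only [hN, Finset.mem_insert, Finset.mem_singleton, Sym2.eq_iff] at h
        have hu' : u ∈ P ∪ T.steiner := mem_of_adj_right hu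
        have hw' : w ∈ P ∪ T.steiner := mem_of_adj_right hw
        rcases h with (h | h) | (h | h) | (h | h) <;> rw [h.1]
        all_goals first | exact Or.inl rfl | (right; assumption))
    (fun a ha b hb => (hvV a ha).symm.trans (hvV b hb))
  have h1 := (hmin T').trans hT'
  have hRD : R ⊆ D := by
    intro e he
    simp only [hR, Finset.mem_insert, Finset.mem_singleton] at he
    rcases he with rfl | rfl
    · exact (hmemD _ _).2 hu
    · exact (hmemD _ _).2 hw
  -- Only inequalities are available: x may be an existing vertex, so the new edges may be
  -- degenerate, coincide with one another or with remaining edges.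
  have h2 : ∑ e ∈ (D \ R) ∪ N, edgeLength e ≤ ∑ e ∈ D \ R, edgeLength e + ∑ e ∈ N, edgeLength e := by
    rw [← Finset.sum_union_inter]
    exact le_add_of_nonneg_right (Finset.sum_nonneg fun e _ => edgeLength_nonneg e)
  have h3 : ∑ e ∈ N, edgeLength e ≤ dist x v + dist x u + dist x w := by
    have hins : ∀ (e : Sym2 E) (S : Finset (Sym2 E)),
        ∑ f ∈ insert e S, edgeLength f ≤ edgeLength e + ∑ f ∈ S, edgeLength f := by
      intro e S
      by_cases he : e ∈ S
      · rw [Finset.insert_eq_of_mem he]; linarith [edgeLength_nonneg e]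
      · rw [Finset.sum_insert he]
    have e1 := hins s(x, v) {s(x, u), s(x, w)}
    have e2 := hins s(x, u) {s(x, w)}
    rw [Finset.sum_singleton] at e2
    simp only [edgeLength_mk] at e1 e2
    linarith
  have h4 := Finset.sum_sdiff (f := edgeLength) hRD
  have h5 : ∑ e ∈ R, edgeLength e = dist v u + dist v w := by
    rw [hR, Finset.sum_pair]
    · simp
    · intro h
      simp only [Sym2.eq_iff] at h
      rcases h with h | h
      · exact huw h.2
      · exact hu.ne h.2.symm
  rw [length_eq] at h1
  linarith

/-- Contracting an edge at a Steiner point of a shortest Steiner tree does not decrease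
the cost. -/
theorem length_le_sum_map (hmin : ∀ T' : SteinerTree P, T.length ≤ T'.length) (hP : P.Nonempty)
    {s u : E} (hs : s ∈ T.steiner) (hu : T.graph.Adj s u) (φ : E → E) (hφs : φ s = u)
    (hφ : ∀ x, x ≠ s → φ x = x) :
    T.length ≤ ∑ e ∈ T.finite_edgeSet.toFinset, edgeLength (Sym2.map φ e) := by
  classical
  set D := T.finite_edgeSet.toFinset with hD
  have hmemD : ∀ a b, s(a, b) ∈ D ↔ T.graph.Adj a b := by simp [hD]
  have hsP : s ∉ P := notMem_of_mem_steiner hs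
  have hφV : ∀ x ∈ P ∪ T.steiner, φ x ∈ (P ∪ T.steiner) \ {s} := by
    intro x hx
    by_cases hxs : x = s
    · rw [hxs, hφs]; exact ⟨mem_of_adj_right hu, hu.ne.symm⟩
    · rw [hφ x hxs]; exact ⟨hx, hxs⟩
  obtain ⟨T', hT'⟩ := exists_length_le hP (V := (P ∪ T.steiner) \ {s})
    (T.finite_verts.sdiff) (fun y hy => ⟨Or.inl hy, fun h => hsP (h ▸ hy)⟩)
    (D.image (Sym2.map φ)) (by
      intro a b h
      obtain ⟨e, he, hab⟩ := Finset.mem_image.1 h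
      induction e with
      | h p q =>
        rw [Sym2.map_mk, Sym2.eq_iff] at hab
        have hpq := (hmemD p q).1 he
        rcases hab with hab | hab
        · rw [← hab.1]; exact hφV p (T.mem_of_adj _ _ hpq)
        · rw [← hab.2]; exact hφV q (mem_of_adj_right hpq))
    (by
      intro a ha b hb
      have h := (T.reachable ha.1 hb.1).of_forall_adj
        (H := SimpleGraph.fromEdgeSet ((D.image (Sym2.map φ) : Finset (Sym2 E)) : Set (Sym2 E)))
        φ (by
          intro p q hpq
          by_cases hne : φ p = φ q
          · rw [hne]
          · refine SimpleGraph.Adj.reachable ((SimpleGraph.fromEdgeSet_adj _).2 ⟨?_, hne⟩)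
            exact Finset.mem_coe.2 (Finset.mem_image.2 ⟨s(p, q), (hmemD p q).2 hpq, rfl⟩))
      rwa [hφ a ha.2, hφ b hb.2] at h)
  refine (hmin T').trans (hT'.trans ?_)
  exact Finset.sum_image_le_of_nonneg fun e _ => edgeLength_nonneg e

/-- The neighbors of a Steiner point of a shortest Steiner tree are not covered by two points,
except when the Steiner point subdivides a segment. -/
theorem dist_add_dist_le_of_neighborSet (hmin : ∀ T' : SteinerTree P, T.length ≤ T'.length)
    (hP : P.Nonempty) {s u w : E} (hs : s ∈ T.steiner) (huw : u ≠ w)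
    (hN : T.graph.neighborSet s = {u, w}) : dist s u + dist s w ≤ dist u w := by
  classical
  have hadj : ∀ x, T.graph.Adj s x ↔ x = u ∨ x = w := fun x => by
    rw [← SimpleGraph.mem_neighborSet, hN]; rfl
  have hu : T.graph.Adj s u := (hadj u).2 (Or.inl rfl)
  have hw : T.graph.Adj s w := (hadj w).2 (Or.inr rfl)
  have h := length_le_sum_map hmin hP hs hu (Function.update id s u) (by simp)
    (fun x hx => by simp [hx])
  rw [length_eq, ← sub_nonneg, ← Finset.sum_sub_distrib] at h
  -- Edges not at s are fixed by the contraction and cancel in the difference of the two sums.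
  rw [← Finset.sum_subset (s₁ := {s(s, u), s(s, w)}), Finset.sum_pair] at h
  · simp [hw.ne.symm, hu.ne.symm] at h
    linarith
  · intro h
    simp only [Sym2.eq_iff] at h
    rcases h with h | h
    · exact huw h.2
    · exact hu.ne h.2.symm
  · intro e he
    simp only [Finset.mem_insert, Finset.mem_singleton] at he
    rcases he with rfl | rfl <;> simpa
  · intro e he he'
    induction e with
    | h p q =>
      have hpq : T.graph.Adj p q := by simpa using he
      have hp : p ≠ s := by
        rintro rfl
        apply he'
        rcases (hadj q).1 hpq with rfl | rfl <;> simp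
      have hq : q ≠ s := by
        rintro rfl
        apply he'
        rcases (hadj p).1 hpq.symm with rfl | rfl <;> simp
      simp [hp, hq]

/-- A Steiner point of a shortest Steiner tree is not a leaf. -/
theorem neighborSet_ne_singleton (hmin : ∀ T' : SteinerTree P, T.length ≤ T'.length)
    (hP : P.Nonempty) {s u : E} (hs : s ∈ T.steiner) : T.graph.neighborSet s ≠ {u} := by
  classical
  intro hN
  have hadj : ∀ x, T.graph.Adj s x ↔ x = u := fun x => by
    rw [← SimpleGraph.mem_neighborSet, hN]; rfl
  have hu : T.graph.Adj s u := (hadj u).2 rfl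
  have h := length_le_sum_map hmin hP hs hu (Function.update id s u) (by simp)
    (fun x hx => by simp [hx])
  rw [length_eq, ← sub_nonneg, ← Finset.sum_sub_distrib] at h
  rw [← Finset.sum_subset (s₁ := {s(s, u)}), Finset.sum_singleton] at h
  · simp [hu.ne.symm] at h
    exact hu.ne h
  · intro e he
    simp only [Finset.mem_singleton] at he
    subst he
    simpa
  · intro e he he'
    induction e with
    | h p q =>
      have hpq : T.graph.Adj p q := by simpa using he
      have hp : p ≠ s := by
        rintro rfl
        apply he'
        rcases (hadj q).1 hpq with rfl
        simp
      have hq : q ≠ s := by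
        rintro rfl
        apply he'
        rcases (hadj p).1 hpq.symm with rfl
        simp
      simp [hp, hq]

theorem finite_neighborSet (T : SteinerTree P) (v : E) : (T.graph.neighborSet v).Finite :=
  T.finite_verts.subset fun _ h => mem_of_adj_right h

theorem exists_adj (T : SteinerTree P) {x y : E} (hx : x ∈ P ∪ T.steiner)
    (hy : y ∈ P ∪ T.steiner) (hxy : x ≠ y) : ∃ z, T.graph.Adj x z := by
  obtain ⟨p⟩ := T.reachable hx hy
  cases p with
  | nil => exact (hxy rfl).elim
  | cons h _ => exact ⟨_, h⟩

end SteinerTree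

/-! ### Unit directions and the 120° condition. -/

section Direction

variable {E : Type*} [NormedAddCommGroup E] [InnerProductSpace ℝ E]

/-- The unit vector pointing from `v` to `u`. -/
noncomputable def direction (v u : E) : E :=
  ‖u - v‖⁻¹ • (u - v)

theorem norm_direction {v u : E} (h : u ≠ v) : ‖direction v u‖ = 1 := by
  have : ‖u - v‖ ≠ 0 := norm_ne_zero_iff.2 (sub_ne_zero.2 h)
  rw [direction, norm_smul, norm_inv, norm_norm, inv_mul_cancel₀ this]

theorem norm_smul_direction (v u : E) : ‖u - v‖ • direction v u = u - v := by
  by_cases h : u = v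
  · simp [h]
  · have : ‖u - v‖ ≠ 0 := norm_ne_zero_iff.2 (sub_ne_zero.2 h)
    rw [direction, smul_inv_smul₀ this]

theorem inner_direction_self {v u : E} (h : u ≠ v) :
    inner ℝ (direction v u) (direction v u) = 1 := by
  rw [real_inner_self_eq_norm_sq, norm_direction h, one_pow]

theorem inner_direction_eq_cos_angle (u v w : E) :
    inner ℝ (direction v u) (direction v w) = Real.cos (EuclideanGeometry.angle u v w) := by
  rw [EuclideanGeometry.angle, InnerProductGeometry.cos_angle, direction, direction,
    real_inner_smul_left, real_inner_smul_right, vsub_eq_sub, vsub_eq_sub, div_eq_mul_inv, mul_inv]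
  ring

theorem two_pi_div_three_le_angle_iff (u v w : E) :
    2 * Real.pi / 3 ≤ EuclideanGeometry.angle u v w ↔
      inner ℝ (direction v u) (direction v w) ≤ -(1 / 2) := by
  have h : Real.cos (2 * Real.pi / 3) = -(1 / 2) := by
    rw [show 2 * Real.pi / 3 = Real.pi - Real.pi / 3 by ring, Real.cos_pi_sub, Real.cos_pi_div_three]
  rw [inner_direction_eq_cos_angle, ← h, Real.strictAntiOn_cos.le_iff_ge]
  · exact ⟨EuclideanGeometry.angle_nonneg _ _ _, EuclideanGeometry.angle_le_pi _ _ _⟩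
  · constructor <;> linarith [Real.pi_pos]

/-- First-order expansion of the norm with an explicit error, valid for every t. It comes from 2‖p -
t b‖‖p‖ ≤ ‖p - t b‖² + ‖p‖². -/
theorem norm_sub_smul_le {p b : E} (hp : p ≠ 0) (t : ℝ) :
    ‖p - t • b‖ ≤ ‖p‖ - t * inner ℝ (‖p‖⁻¹ • p) b + t ^ 2 * (‖b‖ ^ 2 / (2 * ‖p‖)) := by
  have hp' : 0 < ‖p‖ := norm_pos_iff.2 hp
  have h1 : ‖p - t • b‖ ^ 2 = ‖p‖ ^ 2 - 2 * (t * inner ℝ p b) + t ^ 2 * ‖b‖ ^ 2 := by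
    rw [norm_sub_sq_real, real_inner_smul_right, norm_smul, mul_pow, Real.norm_eq_abs, sq_abs]
  have h2 : 0 ≤ (‖p - t • b‖ - ‖p‖) ^ 2 := sq_nonneg _
  rw [real_inner_smul_left]
  have h3 : ‖p - t • b‖ * ‖p‖ ≤ ‖p‖ ^ 2 - t * inner ℝ p b + t ^ 2 * ‖b‖ ^ 2 / 2 := by nlinarith
  have h4 : ‖p‖ - t * (‖p‖⁻¹ * inner ℝ p b) + t ^ 2 * (‖b‖ ^ 2 / (2 * ‖p‖)) =
      (‖p‖ ^ 2 - t * inner ℝ p b + t ^ 2 * ‖b‖ ^ 2 / 2) / ‖p‖ := by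
    field_simp
  rw [h4, le_div_iff₀ hp']
  exact h3

/-- A corner that minimizes the sum of the distances to the corners of a triangle has an angle of
at least 120 degrees. -/
theorem inner_direction_le_of_forall_dist_le {u v w : E} (hu : u ≠ v) (hw : w ≠ v)
    (h : ∀ x : E, dist v u + dist v w ≤ dist x v + dist x u + dist x w) :
    inner ℝ (direction v u) (direction v w) ≤ -(1 / 2) := by
  set b := direction v u + direction v w with hb
  set K := ‖b‖ ^ 2 / (2 * ‖u - v‖) + ‖b‖ ^ 2 / (2 * ‖w - v‖) with hK
  have hb2 : ‖b‖ ^ 2 = 2 + 2 * inner ℝ (direction v u) (direction v w) := by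
    rw [hb, norm_add_sq_real, norm_direction hu, norm_direction hw]; ring
  -- At the test point v + t b, with b the sum of the two directions, the two distances drop by
  -- t‖b‖² to first order while the new edge costs t‖b‖. Letting t tend to 0 gives ‖b‖ ≤ 1.
  have key : ∀ t : ℝ, 0 < t → ‖b‖ ^ 2 ≤ ‖b‖ + t * K := by
    intro t ht
    have h1 := h (v + t • b)
    have e1 := norm_sub_smul_le (b := b) (sub_ne_zero.2 hu) t
    have e2 := norm_sub_smul_le (b := b) (sub_ne_zero.2 hw) t
    rw [dist_comm v u, dist_comm v w, dist_comm _ u, dist_comm _ w, dist_eq_norm, dist_eq_norm,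
      dist_eq_norm, dist_eq_norm, dist_eq_norm, add_sub_cancel_left, norm_smul, Real.norm_eq_abs,
      abs_of_pos ht, ← sub_sub, ← sub_sub] at h1
    have e3 : inner ℝ (‖u - v‖⁻¹ • (u - v)) b + inner ℝ (‖w - v‖⁻¹ • (w - v)) b = ‖b‖ ^ 2 := by
      rw [← inner_add_left, ← real_inner_self_eq_norm_sq, hb]; rfl
    have : t * ‖b‖ ^ 2 ≤ t * (‖b‖ + t * K) := by rw [← e3, hK]; linarith
    exact le_of_mul_le_mul_left this ht
  have h2 : ‖b‖ ^ 2 ≤ ‖b‖ := by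
    refine le_of_forall_pos_le_add fun ε hε => ?_
    have hK0 : 0 ≤ K := by positivity
    refine (key (ε / (K + 1)) (by positivity)).trans ?_
    have : ε / (K + 1) * K ≤ ε := by
      rw [div_mul_eq_mul_div, div_le_iff₀ (by positivity)]
      nlinarith
    linarith
  nlinarith [norm_nonneg b, sq_nonneg (‖b‖ - 1)]

/-- The squared norm of the sum is 3 plus twice the three inner products, hence at most 3 - 3 = 0.
Three angles of at least 120° are therefore exactly 120° and coplanar. -/
theorem add_add_eq_zero_of_inner_le {u v w : E} (hu : ‖u‖ = 1) (hv : ‖v‖ = 1) (hw : ‖w‖ = 1)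
    (huv : inner ℝ u v ≤ -(1 / 2)) (hvw : inner ℝ v w ≤ -(1 / 2)) (huw : inner ℝ u w ≤ -(1 / 2)) :
    u + v + w = 0 := by
  have h : ‖u + v + w‖ ^ 2 = 3 + 2 * (inner ℝ u v + inner ℝ v w + inner ℝ u w) := by
    rw [norm_add_sq_real, norm_add_sq_real, inner_add_left, hu, hv, hw]; ring
  have h0 : ‖u + v + w‖ ^ 2 ≤ 0 := by linarith
  exact norm_eq_zero.1 (pow_eq_zero_iff two_ne_zero |>.1 (le_antisymm h0 (sq_nonneg _)))

theorem inner_eq_of_add_add_eq_zero {u v w : E} (hu : ‖u‖ = 1) (hv : ‖v‖ = 1) (hw : ‖w‖ = 1)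
    (h : u + v + w = 0) : inner ℝ u v = -(1 / 2 : ℝ) := by
  have h1 : ‖u + v‖ ^ 2 = 1 := by
    rw [eq_neg_of_add_eq_zero_left h, norm_neg, hw, one_pow]
  rw [norm_add_sq_real, hu, hv] at h1
  linarith

/-- At most three directions have pairwise angles of at least 120 degrees. -/
theorem card_le_three_of_inner_le {N : Finset E} (h1 : ∀ u ∈ N, ‖u‖ = 1)
    (h2 : ∀ u ∈ N, ∀ v ∈ N, u ≠ v → inner ℝ u v ≤ -(1 / 2 : ℝ)) : N.card ≤ 3 := by
  classical
  by_contra! hc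
  have h0 : (0 : ℝ) ≤ inner ℝ (∑ u ∈ N, u) (∑ v ∈ N, v) := real_inner_self_nonneg
  rw [sum_inner] at h0
  -- With four or more vectors each row of the Gram matrix has a negative sum, although the sum of
  -- all entries is a squared norm.
  have hrow : ∀ u ∈ N, inner ℝ u (∑ v ∈ N, v) ≤ 1 - (N.card - 1) * (1 / 2 : ℝ) := by
    intro u hu
    rw [inner_sum, ← Finset.add_sum_erase N _ hu, real_inner_self_eq_norm_sq, h1 u hu]
    have := Finset.sum_le_card_nsmul (N.erase u) (fun v => inner ℝ u v) (-(1 / 2))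
      (fun v hv => h2 u hu v (Finset.mem_of_mem_erase hv) (Finset.ne_of_mem_erase hv).symm)
    rw [Finset.card_erase_of_mem hu, nsmul_eq_mul, Nat.cast_sub (by omega), Nat.cast_one] at this
    linarith
  have hsum := Finset.sum_le_card_nsmul N _ _ hrow
  rw [nsmul_eq_mul] at hsum
  have hc' : (4 : ℝ) ≤ N.card := by exact_mod_cast hc
  nlinarith

theorem direction_injOn {v : E} {N : Set E}
    (h : ∀ u ∈ N, ∀ w ∈ N, u ≠ w → inner ℝ (direction v u) (direction v w) ≤ -(1 / 2 : ℝ)) :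
    Set.InjOn (direction v) N := by
  intro u hu w hw huw
  by_contra hne
  have h1 := h u hu w hw hne
  rw [huw] at h1
  have := real_inner_self_nonneg (x := direction v w)
  linarith

end Direction

/-! ### Optimal trees are candidate-optimal; the maximum principle. -/

namespace SteinerTree

variable {E : Type*} [NormedAddCommGroup E] [InnerProductSpace ℝ E] {P : Set E}
  {T : SteinerTree P}

theorem IsOptimal.inner_direction_le (hT : T.IsOptimal) (hP : P.Nonempty) {u v w : E}
    (hu : T.graph.Adj v u) (hw : T.graph.Adj v w) (huw : u ≠ w) :
    inner ℝ (direction v u) (direction v w) ≤ -(1 / 2 : ℝ) :=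
  inner_direction_le_of_forall_dist_le hu.ne.symm hw.ne.symm
    (dist_add_dist_le hT.1 hP hu hw huw)

theorem mem_segment_of_dist_add_dist_le {s u w : E} (h : dist s u + dist s w ≤ dist u w) :
    s ∈ segment ℝ u w := by
  rw [mem_segment_iff_wbtw, ← dist_add_dist_eq_iff, dist_comm u s]
  refine le_antisymm h ?_
  rw [dist_comm s u]
  exact dist_triangle _ _ _

/-- The angle condition bounds the degree of a Steiner point by 3. Degree 0 contradicts
connectedness, degree 1 contradicts minimality by contraction, and at degree 2 contraction puts the
point on the segment between its neighbors, which optimality excludes. -/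
theorem IsOptimal.isCandidateOptimal (hT : T.IsOptimal) (hP : P.Nonempty) :
    T.IsCandidateOptimal := by
  classical
  refine ⟨fun u v w hu hw huw => (two_pi_div_three_le_angle_iff u v w).2
    (hT.inner_direction_le hP hu hw huw), fun s hs => ?_⟩
  have hfin := T.finite_neighborSet s
  have hle : (T.graph.neighborSet s).ncard ≤ 3 := by
    have hinner : ∀ u ∈ T.graph.neighborSet s, ∀ w ∈ T.graph.neighborSet s, u ≠ w →
        inner ℝ (direction s u) (direction s w) ≤ -(1 / 2 : ℝ) :=
      fun u hu w hw huw => hT.inner_direction_le hP hu hw huw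
    have hinj := direction_injOn hinner
    rw [← hinj.ncard_image, Set.ncard_eq_toFinset_card _ (hfin.image _)]
    refine card_le_three_of_inner_le ?_ ?_
    · intro u hu
      obtain ⟨z, hz, rfl⟩ := (Set.Finite.mem_toFinset _).1 hu
      exact norm_direction (SimpleGraph.Adj.ne hz).symm
    · intro u hu v hv huv
      obtain ⟨z, hz, rfl⟩ := (Set.Finite.mem_toFinset _).1 hu
      obtain ⟨y, hy, rfl⟩ := (Set.Finite.mem_toFinset _).1 hv
      exact hinner z hz y hy fun h => huv (by rw [h])
  have h0 : (T.graph.neighborSet s).ncard ≠ 0 := by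
    intro h
    rw [Set.ncard_eq_zero hfin] at h
    obtain ⟨p, hp⟩ := hP
    obtain ⟨z, hz⟩ := T.exists_adj (x := s) (y := p) (Or.inr hs) (Or.inl hp)
      (fun h => notMem_of_mem_steiner hs (h ▸ hp))
    have : z ∈ T.graph.neighborSet s := hz
    rw [h] at this
    exact this
  have h1 : (T.graph.neighborSet s).ncard ≠ 1 := by
    intro h
    obtain ⟨u, hu⟩ := Set.ncard_eq_one.1 h
    exact neighborSet_ne_singleton hT.1 hP hs hu
  have h2 : (T.graph.neighborSet s).ncard ≠ 2 := by
    intro h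
    obtain ⟨u, w, huw, hN⟩ := Set.ncard_eq_two.1 h
    exact hT.2 s hs ⟨u, w, huw, hN, mem_segment_of_dist_add_dist_le
      (dist_add_dist_le_of_neighborSet hT.1 hP hs huw hN)⟩
  omega

namespace IsCandidateOptimal

theorem inner_direction_le (hT : T.IsCandidateOptimal) {u v w : E}
    (hu : T.graph.Adj v u) (hw : T.graph.Adj v w) (huw : u ≠ w) :
    inner ℝ (direction v u) (direction v w) ≤ -(1 / 2 : ℝ) :=
  (two_pi_div_three_le_angle_iff u v w).1 (hT.1 u v w hu hw huw)

theorem direction_add_eq_zero (hT : T.IsCandidateOptimal) {s a b c : E} (ha : T.graph.Adj s a)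
    (hb : T.graph.Adj s b) (hc : T.graph.Adj s c) (hab : a ≠ b) (hac : a ≠ c) (hbc : b ≠ c) :
    direction s a + direction s b + direction s c = 0 :=
  add_add_eq_zero_of_inner_le (norm_direction ha.ne.symm) (norm_direction hb.ne.symm)
    (norm_direction hc.ne.symm) (hT.inner_direction_le ha hb hab)
    (hT.inner_direction_le hb hc hbc) (hT.inner_direction_le ha hc hac)

/-- The neighbors of a Steiner point, with a given one of them first. -/
theorem exists_neighborSet_eq (hT : T.IsCandidateOptimal) {s a : E} (hs : s ∈ T.steiner)
    (ha : T.graph.Adj s a) :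
    ∃ b c, T.graph.Adj s b ∧ T.graph.Adj s c ∧ a ≠ b ∧ a ≠ c ∧ b ≠ c ∧
      T.graph.neighborSet s = {a, b, c} := by
  have hcard : (T.graph.neighborSet s \ {a}).ncard = 2 := by
    rw [Set.ncard_sdiff_singleton_of_mem (show a ∈ T.graph.neighborSet s from ha), hT.2 s hs]
  obtain ⟨b, c, hbc, h⟩ := Set.ncard_eq_two.1 hcard
  have hb : b ∈ T.graph.neighborSet s \ {a} := by rw [h]; simp
  have hc : c ∈ T.graph.neighborSet s \ {a} := by rw [h]; simp
  refine ⟨b, c, hb.1, hc.1, fun e => hb.2 e.symm, fun e => hc.2 e.symm, hbc, ?_⟩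
  rw [← h, Set.insert_sdiff_singleton, Set.insert_eq_of_mem]
  exact ha

/-- The maximum principle: a set of vertices is contained in the convex hull of a part of it if
the remaining vertices are Steiner points with all neighbors in the set. -/
theorem subset_convexHull_of_steiner (hT : T.IsCandidateOptimal) {C F : Set E} (hFC : F ⊆ C)
    (hC : C ⊆ P ∪ T.steiner) (hF : F.Nonempty)
    (hcl : ∀ z ∈ C, z ∉ F → z ∈ T.steiner ∧ ∀ x, T.graph.Adj z x → x ∈ C) :
    C ⊆ convexHull ℝ F := by
  intro z₀ hz₀
  by_contra hz
  have hCfin : C.Finite := T.finite_verts.subset hC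
  have hFfin : F.Finite := hCfin.subset hFC
  obtain ⟨f, u, hfu, huz⟩ := geometric_hahn_banach_closed_point (convex_convexHull ℝ F)
    (hFfin.isCompact_convexHull (𝕜 := ℝ)).isClosed hz
  obtain ⟨z, hzC, hmax⟩ := Set.exists_max_image C f hCfin ⟨z₀, hz₀⟩
  have huz' : u < f z := huz.trans_le (hmax z₀ hz₀)
  have hFu : ∀ x ∈ F, f x < f z := fun x hx => (hfu x (subset_convexHull ℝ F hx)).trans huz'
  obtain ⟨p, hp⟩ := hF
  -- At a maximizer of the separating functional f, the three directions have nonpositive f-values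
  -- with sum zero, so all neighbors are maximizers too. By connectedness the maximum would spread
  -- to F, where f is smaller.
  have hclosed : ∀ x y, T.graph.Adj x y → x ∈ {x ∈ C | f x = f z} → y ∈ {x ∈ C | f x = f z} := by
    rintro x y hxy ⟨hxC, hx⟩
    obtain ⟨hxS, hnb⟩ := hcl x hxC fun h => (hFu x h).ne hx
    obtain ⟨b, c, hb, hc, hyb, hyc, hbc, -⟩ := hT.exists_neighborSet_eq hxS hxy
    refine ⟨hnb y hxy, ?_⟩
    have hsum := congrArg f (hT.direction_add_eq_zero hxy hb hc hyb hyc hbc)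
    have hnonpos : ∀ a, T.graph.Adj x a → f (direction x a) ≤ 0 := by
      intro a ha
      rw [direction, map_smul, map_sub, hx, smul_eq_mul]
      exact mul_nonpos_of_nonneg_of_nonpos (by positivity) (sub_nonpos.2 (hmax a (hnb a ha)))
    rw [map_add, map_add, map_zero] at hsum
    have h0 : f (direction x y) = 0 := by
      linarith [hnonpos y hxy, hnonpos b hb, hnonpos c hc]
    rw [direction, map_smul, map_sub, hx, smul_eq_mul, mul_eq_zero, inv_eq_zero, norm_eq_zero,
      sub_eq_zero, sub_eq_zero] at h0
    exact h0.resolve_left hxy.ne.symm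
  have := (T.reachable (hC hzC) (hC (hFC hp))).mem_of_forall_adj_mem hclosed ⟨hzC, rfl⟩
  exact (hFu p hp).ne this.2

end IsCandidateOptimal

end SteinerTree

/-! ### Coordinates on the regular simplex. -/

section BasisVec

variable {n : ℕ}

theorem basisVec_apply (i j : Fin n) : basisVec i j = if j = i then 1 else 0 := by
  simp [basisVec]

@[simp]
theorem basisVec_self (i : Fin n) : basisVec i i = 1 := by
  simp [basisVec_apply]

theorem basisVec_of_ne {i j : Fin n} (h : j ≠ i) : basisVec i j = 0 := by
  simp [basisVec_apply, h]

theorem basisVec_injective : Function.Injective (basisVec : Fin n → _) := by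
  intro i j h
  by_contra hij
  have := congrArg (fun x : EuclideanSpace ℝ (Fin n) => x i) h
  simp [basisVec_of_ne hij] at this

theorem basisVec_mem (i : Fin n) : basisVec i ∈ simplexVertices n :=
  ⟨i, rfl⟩

theorem norm_basisVec (i : Fin n) : ‖basisVec i‖ = 1 := by
  simp [basisVec]

theorem inner_basisVec (i : Fin n) (x : EuclideanSpace ℝ (Fin n)) :
    inner ℝ (basisVec i) x = x i := by
  simp [basisVec, EuclideanSpace.inner_single_left]

theorem simplexVertices_nonempty (hn : 3 ≤ n) : (simplexVertices n).Nonempty :=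
  ⟨_, basisVec_mem ⟨0, by omega⟩⟩

theorem ncard_simplexVertices : (simplexVertices n).ncard = n := by
  rw [simplexVertices, ← Set.image_univ, basisVec_injective.injOn.ncard_image, Set.ncard_univ,
    Nat.card_eq_fintype_card, Fintype.card_fin]

theorem sum_basisVec (i : Fin n) : ∑ j, basisVec i j = 1 := by
  simp [basisVec_apply]

theorem dist_basisVec {i j : Fin n} (h : i ≠ j) :
    dist (basisVec i) (basisVec j) = Real.sqrt 2 := by
  rw [dist_eq_norm, ← Real.sqrt_sq (norm_nonneg _), norm_sub_sq_real, norm_basisVec, norm_basisVec,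
    inner_basisVec, basisVec_of_ne h]
  norm_num

theorem mem_convexHull_simplexVertices {x : EuclideanSpace ℝ (Fin n)}
    (h : x ∈ convexHull ℝ (simplexVertices n)) : (∀ i, 0 ≤ x i) ∧ ∑ i, x i = 1 := by
  have hconv : Convex ℝ {x : EuclideanSpace ℝ (Fin n) | (∀ i, 0 ≤ x i) ∧ ∑ i, x i = 1} := by
    rintro x ⟨hx, hx'⟩ y ⟨hy, hy'⟩ a b ha hb hab
    refine ⟨fun i => ?_, ?_⟩
    · have := hx i
      have := hy i
      simp only [PiLp.add_apply, PiLp.smul_apply, smul_eq_mul]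
      positivity
    · simp only [PiLp.add_apply, PiLp.smul_apply, smul_eq_mul, Finset.sum_add_distrib,
        ← Finset.mul_sum, hx', hy', mul_one, hab]
  refine convexHull_min ?_ hconv h
  rintro _ ⟨i, rfl⟩
  refine ⟨fun j => ?_, sum_basisVec i⟩
  rw [basisVec_apply]
  split_ifs <;> norm_num

theorem eq_basisVec_of_one_le {x : EuclideanSpace ℝ (Fin n)} (h0 : ∀ j, 0 ≤ x j)
    (h1 : ∑ j, x j = 1) {i : Fin n} (hi : 1 ≤ x i) : x = basisVec i := by
  have h := Finset.add_sum_erase Finset.univ (fun j => x j) (Finset.mem_univ i)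
  have hnn : 0 ≤ ∑ j ∈ Finset.univ.erase i, x j := Finset.sum_nonneg fun j _ => h0 j
  simp only at h
  have hz : ∑ j ∈ Finset.univ.erase i, x j = 0 := by linarith
  rw [Finset.sum_eq_zero_iff_of_nonneg fun j _ => h0 j] at hz
  ext j
  rw [basisVec_apply]
  split_ifs with hj
  · subst hj; linarith
  · exact hz j (Finset.mem_erase.2 ⟨hj, Finset.mem_univ j⟩)

theorem norm_sq_le_sum_sq {x : EuclideanSpace ℝ (Fin n)} (h0 : ∀ j, 0 ≤ x j) :
    ‖x‖ ^ 2 ≤ (∑ j, x j) ^ 2 := by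
  rw [EuclideanSpace.real_norm_sq_eq, sq (∑ j, x j), Finset.sum_mul]
  refine Finset.sum_le_sum fun j _ => ?_
  rw [sq]
  exact mul_le_mul_of_nonneg_left
    (Finset.single_le_sum (fun k _ => h0 k) (Finset.mem_univ j)) (h0 j)

/-- Points of the hull of `s` and some vertices of the simplex, as seen from `s`. -/
theorem exists_sub_eq_of_mem_convexHull {s p : EuclideanSpace ℝ (Fin n)} {A : Set (Fin n)}
    (h : p ∈ convexHull ℝ (insert s (basisVec '' A))) :
    ∃ V : EuclideanSpace ℝ (Fin n), (∀ j, 0 ≤ V j) ∧ (∀ j, j ∉ A → V j = 0) ∧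
      p - s = V - (∑ j, V j) • s := by
  have hconv : Convex ℝ {p | ∃ V : EuclideanSpace ℝ (Fin n), (∀ j, 0 ≤ V j) ∧
      (∀ j, j ∉ A → V j = 0) ∧ p - s = V - (∑ j, V j) • s} := by
    rintro x ⟨V, hV, hVA, hx⟩ y ⟨W, hW, hWA, hy⟩ a b ha hb hab
    refine ⟨a • V + b • W, fun j => ?_, fun j hj => ?_, ?_⟩
    · have := hV j
      have := hW j
      simp only [PiLp.add_apply, PiLp.smul_apply, smul_eq_mul]
      positivity
    · simp [hVA j hj, hWA j hj]
    · have e : a • x + b • y - s = a • (x - s) + b • (y - s) + (a + b - 1) • s := by module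
      rw [e, hab, hx, hy]
      simp only [PiLp.add_apply, PiLp.smul_apply, smul_eq_mul, Finset.sum_add_distrib,
        ← Finset.mul_sum]
      module
  refine convexHull_min ?_ hconv h
  rintro _ (rfl | ⟨i, hi, rfl⟩)
  · exact ⟨0, by simp, by simp, by simp⟩
  · refine ⟨basisVec i, fun j => ?_, fun j hj => basisVec_of_ne fun e => hj (e ▸ hi), ?_⟩
    · rw [basisVec_apply]
      split_ifs <;> norm_num
    · rw [sum_basisVec, one_smul]

end BasisVec

/-! ### The algebra behind the lower bound on terminal edges. -/

section LeafLength

/-- Here a = ‖V‖² and b = ‖W‖²; `h1` and `h2` are the squared norms of q u and q (v - w), where q =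
1 + r(y + z). The argument is by contradiction in the two quantities X = r(y + z) and m = yz. -/
theorem one_third_lt_sq {y z r a b : ℝ} (hy : 0 ≤ y) (hz : 0 ≤ z) (hr : 0 < r)
    (ha : a ≤ y ^ 2) (hb : b ≤ z ^ 2) (ha0 : 0 ≤ a) (hb0 : 0 ≤ b)
    (h1 : (1 + r * (y + z)) ^ 2 = (y + z) ^ 2 + a + b)
    (h2 : 3 * (1 + r * (y + z)) ^ 2 =
      (y - z) ^ 2 + (1 + 2 * r * z) ^ 2 * a + (1 + 2 * r * y) ^ 2 * b) :
    1 / 3 < r ^ 2 := by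
  by_contra! hr3
  obtain ⟨X, hX⟩ : ∃ X, X = r * (y + z) := ⟨_, rfl⟩
  obtain ⟨Λ, hΛ⟩ : ∃ Λ, Λ = y + z := ⟨_, rfl⟩
  obtain ⟨m, hm⟩ : ∃ m, m = y * z := ⟨_, rfl⟩
  have hX0 : 0 ≤ X := by rw [hX]; positivity
  have hm0 : 0 ≤ m := by rw [hm]; positivity
  have hmΛ : 4 * m ≤ Λ ^ 2 := by rw [hm, hΛ]; nlinarith [sq_nonneg (y - z)]
  have hXΛ : X ^ 2 = r ^ 2 * Λ ^ 2 := by rw [hX, hΛ]; ring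
  have hΛq : Λ ^ 2 ≤ (1 + X) ^ 2 := by rw [hX, hΛ]; linarith
  -- This is `h2` minus `h1`, with a and b replaced by their upper bounds y² and z².
  have hkey : 2 * (1 + X) ^ 2 ≤ 4 * m * (X - 1) + 8 * r ^ 2 * m ^ 2 := by
    have e1 : (4 * r * z + 4 * r ^ 2 * z ^ 2) * a ≤ (4 * r * z + 4 * r ^ 2 * z ^ 2) * y ^ 2 :=
      mul_le_mul_of_nonneg_left ha (by positivity)
    have e2 : (4 * r * y + 4 * r ^ 2 * y ^ 2) * b ≤ (4 * r * y + 4 * r ^ 2 * y ^ 2) * z ^ 2 :=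
      mul_le_mul_of_nonneg_left hb (by positivity)
    rw [hX, hm]
    linarith
  have hm2 : 16 * m ^ 2 ≤ Λ ^ 2 * Λ ^ 2 := by
    have := mul_le_mul hmΛ hmΛ (by positivity) (by positivity)
    linarith
  have hrm : 16 * (r ^ 2 * m ^ 2) ≤ X ^ 2 * Λ ^ 2 := by
    rw [hXΛ]
    have := mul_le_mul_of_nonneg_left hm2 (sq_nonneg r)
    linarith
  have hX3 : 3 * X ^ 2 ≤ (1 + X) ^ 2 := by
    rw [hXΛ]
    have := mul_le_mul_of_nonneg_right hr3 (sq_nonneg Λ)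
    linarith
  have hq : 0 < (1 + X) ^ 2 := by positivity
  have hXsq : X ^ 2 * Λ ^ 2 ≤ X ^ 2 * (1 + X) ^ 2 := mul_le_mul_of_nonneg_left hΛq (sq_nonneg X)
  -- The sign of X - 1 decides how m is estimated. For X ≥ 1, 4m ≤ (1 + X)² gives X + X²/2 ≥ 3,
  -- which with 3X² ≤ (1 + X)² yields X ≥ 11/6, contradicting 2X² ≤ 1 + 2X. For X < 1, that term is
  -- dropped and X² ≥ 4 results.
  rcases le_or_gt 1 X with h | h
  · have e1 : 4 * m * (X - 1) ≤ (1 + X) ^ 2 * (X - 1) :=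
      mul_le_mul_of_nonneg_right (hmΛ.trans hΛq) (by linarith)
    have e2 : (1 + X) ^ 2 * 2 ≤ (1 + X) ^ 2 * (X - 1 + X ^ 2 / 2) := by linarith
    have e3 := le_of_mul_le_mul_left e2 hq
    have e4 : 11 / 6 ≤ X := by linarith
    have e5 : 11 / 6 * X ≤ X * X := mul_le_mul_of_nonneg_right e4 hX0
    linarith
  · have e1 : 4 * m * (X - 1) ≤ 0 :=
      mul_nonpos_of_nonneg_of_nonpos (by positivity) (by linarith)
    have e2 : (1 + X) ^ 2 * 2 ≤ (1 + X) ^ 2 * (X ^ 2 / 2) := by linarith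
    have e3 := le_of_mul_le_mul_left e2 hq
    have e4 : X * X ≤ 1 * 1 := mul_le_mul h.le h.le hX0 zero_le_one
    linarith

variable {E : Type*} [NormedAddCommGroup E] [InnerProductSpace ℝ E]

theorem norm_sq_add_add_of_orthogonal {e V W : E} (he : ‖e‖ = 1) (heV : inner ℝ e V = (0 : ℝ))
    (heW : inner ℝ e W = (0 : ℝ)) (hVW : inner ℝ V W = (0 : ℝ)) (α β γ : ℝ) :
    ‖α • e + β • V + γ • W‖ ^ 2 = α ^ 2 + β ^ 2 * ‖V‖ ^ 2 + γ ^ 2 * ‖W‖ ^ 2 := by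
  rw [norm_add_sq_real, norm_add_sq_real, inner_add_left]
  simp only [real_inner_smul_left, real_inner_smul_right, heV, heW, hVW, norm_smul, mul_pow,
    Real.norm_eq_abs, sq_abs, he]
  ring

/-- Substituting s = e - r u into u = -(v + w) and into v - w expresses q u and q (v - w) in the
orthogonal vectors e, V, W. Pythagoras then gives the two equations of `one_third_lt_sq`, the 3
being ‖v - w‖² at an angle of 120°. -/
theorem one_third_lt_sq_of_directions {e V W s u v w : E} {y z r : ℝ} (he : ‖e‖ = 1)
    (heV : inner ℝ e V = (0 : ℝ)) (heW : inner ℝ e W = (0 : ℝ)) (hVW : inner ℝ V W = (0 : ℝ))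
    (hu : ‖u‖ = 1) (hv : ‖v‖ = 1) (hw : ‖w‖ = 1) (huvw : u + v + w = 0) (hs : s = e - r • u)
    (hvV : v = V - y • s) (hwW : w = W - z • s) (hy : 0 ≤ y) (hz : 0 ≤ z) (hr : 0 < r)
    (hV : ‖V‖ ^ 2 ≤ y ^ 2) (hW : ‖W‖ ^ 2 ≤ z ^ 2) : 1 / 3 < r ^ 2 := by
  have hvw : inner ℝ v w = -(1 / 2 : ℝ) :=
    inner_eq_of_add_add_eq_zero hv hw hu (by rw [← huvw]; abel)
  set q := 1 + r * (y + z) with hq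
  have e1 : q • u = (y + z) • e + (-1 : ℝ) • V + (-1 : ℝ) • W := by
    have h : u = (y + z) • s - V - W := by
      have : u = -(v + w) := by rw [eq_neg_iff_add_eq_zero, ← huvw]; abel
      rw [this, hvV, hwW]; module
    have h' : u = (y + z) • (e - r • u) - V - W := by rw [← hs]; exact h
    have : q • u = u + (r * (y + z)) • u := by rw [hq]; module
    rw [this]
    nth_rewrite 1 [h']
    module
  have e2 : q • (v - w) = (-(y - z)) • e + (1 + 2 * r * z) • V + (-(1 + 2 * r * y)) • W := by
    have h : q • s = q • e - r • (q • u) := by rw [hs]; module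
    have : q • (v - w) = q • V - q • W - (y - z) • (q • s) := by rw [hvV, hwW]; module
    rw [this, h, e1, hq]
    module
  have n1 := congrArg (fun x => ‖x‖ ^ 2) e1
  have n2 := congrArg (fun x => ‖x‖ ^ 2) e2
  simp only [norm_sq_add_add_of_orthogonal he heV heW hVW, norm_smul, mul_pow, Real.norm_eq_abs,
    sq_abs, hu] at n1 n2
  rw [norm_sub_sq_real, hv, hw, hvw] at n2
  refine one_third_lt_sq hy hz hr hV hW (by positivity) (by positivity) ?_ ?_
  · linarith
  · linarith

end LeafLength

/-! ### Candidate-optimal trees of the simplex: leaves, fullness, long terminal edges. -/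

namespace SteinerTree.IsCandidateOptimal

variable {n : ℕ} {T : SimplexSteinerTree n}

theorem mem_simplex (hT : T.IsCandidateOptimal) (hn : 3 ≤ n) {x : EuclideanSpace ℝ (Fin n)}
    (hx : x ∈ simplexVertices n ∪ T.steiner) : (∀ i, 0 ≤ x i) ∧ ∑ i, x i = 1 := by
  refine mem_convexHull_simplexVertices
    (hT.subset_convexHull_of_steiner Set.subset_union_left subset_rfl (simplexVertices_nonempty hn)
      (fun z hz hzP => ⟨hz.resolve_left hzP, fun y hy => mem_of_adj_right hy⟩) hx)

theorem apply_lt_one (hT : T.IsCandidateOptimal) (hn : 3 ≤ n) {x : EuclideanSpace ℝ (Fin n)}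
    (hx : x ∈ T.steiner) (i : Fin n) : x i < 1 := by
  by_contra! h
  obtain ⟨h0, h1⟩ := hT.mem_simplex hn (Or.inr hx)
  exact notMem_of_mem_steiner hx (eq_basisVec_of_one_le h0 h1 h ▸ basisVec_mem i)

/-- Two points p, q of the simplex are seen from e_i under an angle of at most 90°, because the
inner product of p - e_i and q - e_i is at least (1 - p_i)(1 - q_i) ≥ 0. -/
theorem eq_of_adj_basisVec (hT : T.IsCandidateOptimal) (hn : 3 ≤ n) {i : Fin n}
    {p q : EuclideanSpace ℝ (Fin n)} (hp : T.graph.Adj (basisVec i) p)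
    (hq : T.graph.Adj (basisVec i) q) : p = q := by
  by_contra hpq
  have h := hT.inner_direction_le hp hq hpq
  obtain ⟨p0, p1⟩ := hT.mem_simplex hn (mem_of_adj_right hp)
  obtain ⟨q0, q1⟩ := hT.mem_simplex hn (mem_of_adj_right hq)
  have hpi : p i ≤ 1 := p1 ▸ Finset.single_le_sum (fun k _ => p0 k) (Finset.mem_univ i)
  have hqi : q i ≤ 1 := q1 ▸ Finset.single_le_sum (fun k _ => q0 k) (Finset.mem_univ i)
  have hpq' : p i * q i ≤ inner ℝ p q := by
    rw [PiLp.inner_apply]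
    have := Finset.single_le_sum (f := fun k => p k * q k)
      (fun k _ => mul_nonneg (p0 k) (q0 k)) (Finset.mem_univ i)
    refine this.trans (le_of_eq (Finset.sum_congr rfl fun k _ => ?_))
    simp [mul_comm]
  have hinner : 0 ≤ inner ℝ (p - basisVec i) (q - basisVec i) := by
    have hp' : inner ℝ p (basisVec i) = p i := by rw [real_inner_comm, inner_basisVec]
    rw [inner_sub_left, inner_sub_right, inner_basisVec, PiLp.sub_apply, basisVec_self, hp']
    nlinarith [mul_nonneg (sub_nonneg.2 hpi) (sub_nonneg.2 hqi)]
  rw [direction, direction, real_inner_smul_left, real_inner_smul_right] at h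
  have : 0 ≤ ‖p - basisVec i‖⁻¹ * (‖q - basisVec i‖⁻¹ *
      inner ℝ (p - basisVec i) (q - basisVec i)) := by positivity
  linarith

/-- Every terminal is a leaf attached to a Steiner point. -/
theorem exists_neighborSet_basisVec (hT : T.IsCandidateOptimal) (hn : 3 ≤ n) (i : Fin n) :
    ∃ s ∈ T.steiner, T.graph.neighborSet (basisVec i) = {s} := by
  have : Nontrivial (Fin n) := Fin.nontrivial_iff_two_le.2 (by omega)
  obtain ⟨j, hj⟩ := exists_ne i
  obtain ⟨s, hs⟩ := T.exists_adj (x := basisVec i) (y := basisVec j) (Or.inl (basisVec_mem i))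
    (Or.inl (basisVec_mem j)) (basisVec_injective.ne hj.symm)
  refine ⟨s, ?_, ?_⟩
  · refine (mem_of_adj_right hs).resolve_left ?_
    rintro ⟨k, rfl⟩
    -- Two adjacent terminals, each with a single neighbor, would form a whole component; a third
    -- terminal contradicts this.
    obtain ⟨l, hl⟩ : ∃ l : Fin n, l ∉ ({i, k} : Finset (Fin n)) := by
      by_contra! h
      have h1 := Finset.card_le_card (fun l _ => h l : Finset.univ ⊆ ({i, k} : Finset (Fin n)))
      have h2 := Finset.card_le_two (a := i) (b := k)
      rw [Finset.card_univ, Fintype.card_fin] at h1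
      omega
    have hcl : ∀ x y, T.graph.Adj x y → x ∈ ({basisVec i, basisVec k} : Set _) →
        y ∈ ({basisVec i, basisVec k} : Set _) := by
      rintro x y hxy (rfl | rfl)
      · exact Or.inr (hT.eq_of_adj_basisVec hn hxy hs)
      · exact Or.inl (hT.eq_of_adj_basisVec hn hxy hs.symm)
    have h := (T.reachable (Or.inl (basisVec_mem i))
      (Or.inl (basisVec_mem l))).mem_of_forall_adj_mem hcl (Or.inl rfl)
    rcases h with h | h
    · exact hl (by simp [basisVec_injective h])
    · exact hl (by simp [basisVec_injective h])
  · ext x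
    exact ⟨fun hx => hT.eq_of_adj_basisVec hn hx hs, fun hx => by
      rw [Set.mem_singleton_iff.1 hx]; exact hs⟩

/-- Degree count: terminals have degree 1 and Steiner points degree 3, so n + 3|S| = 2(n + |S| - 1).
-/
theorem isFull (hT : T.IsCandidateOptimal) (hn : 3 ≤ n) : T.IsFull := by
  classical
  have : Fintype ↥(simplexVertices n ∪ T.steiner) := T.finite_verts.fintype
  have : Fintype (simplexVertices n) := (T.finite_verts.subset Set.subset_union_left).fintype
  have : Fintype T.steiner := (T.finite_verts.subset Set.subset_union_right).fintype
  set G := T.graph.induce (simplexVertices n ∪ T.steiner) with hG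
  have hdeg : ∀ v, G.degree v = (T.graph.neighborSet v).ncard := by
    intro v
    rw [← SimpleGraph.card_neighborSet_eq_degree, ← Nat.card_eq_fintype_card,
      Nat.card_coe_set_eq, ← Set.ncard_image_of_injective _ Subtype.val_injective]
    congr 1
    ext x
    constructor
    · rintro ⟨y, hy, rfl⟩
      exact hy
    · intro hx
      exact ⟨⟨x, mem_of_adj_right hx⟩, hx, rfl⟩
  have h1 := G.sum_degrees_eq_twice_card_edges
  have h2 := T.isTree.card_edgeFinset
  have h3 : ∑ v, G.degree v = (simplexVertices n).ncard + 3 * T.steiner.ncard := by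
    simp only [hdeg]
    rw [Finset.sum_set_coe (f := fun v => (T.graph.neighborSet v).ncard), Set.toFinset_union,
      Finset.sum_union (Set.disjoint_toFinset.2 T.disjoint), Set.ncard_eq_toFinset_card',
      Set.ncard_eq_toFinset_card']
    congr 1
    · rw [Finset.card_eq_sum_ones]
      refine Finset.sum_congr rfl fun x hx => ?_
      obtain ⟨i, rfl⟩ := Set.mem_toFinset.1 hx
      obtain ⟨s, -, hs⟩ := hT.exists_neighborSet_basisVec hn i
      rw [hs, Set.ncard_singleton]
    · rw [Finset.sum_const_nat (m := 3), mul_comm]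
      exact fun x hx => hT.2 x (Set.mem_toFinset.1 hx)
  have h4 : Fintype.card ↥(simplexVertices n ∪ T.steiner) =
      (simplexVertices n).ncard + T.steiner.ncard := by
    rw [← Set.ncard_union_eq T.disjoint (T.finite_verts.subset Set.subset_union_left)
      (T.finite_verts.subset Set.subset_union_right), ← Nat.card_eq_fintype_card,
      Nat.card_coe_set_eq]
  have h5 : G.edgeFinset.card = (T.graph.induce (simplexVertices n ∪ T.steiner)).edgeFinset.card :=
    rfl
  rw [IsFull]
  omega

/-- The branch behind a neighbor of a Steiner point lies in the hull of the Steiner point and the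
terminals of the branch. -/
theorem mem_convexHull_branch (hT : T.IsCandidateOptimal) {s a : EuclideanSpace ℝ (Fin n)}
    (ha : T.graph.Adj s a) :
    a ∈ convexHull ℝ (insert s
      (basisVec '' {j | (T.graph.deleteIncidenceSet s).Reachable a (basisVec j)})) := by
  -- The set is s with the component of a off s. Its members other than s and the terminals are
  -- Steiner points whose neighbors stay inside.
  refine hT.subset_convexHull_of_steiner
    (C := insert s {x | (T.graph.deleteIncidenceSet s).Reachable a x}) ?_ ?_ ⟨s, Or.inl rfl⟩ ?_
    (Or.inr (SimpleGraph.Reachable.refl _))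
  · rintro _ (rfl | ⟨j, hj, rfl⟩)
    · exact Or.inl rfl
    · exact Or.inr hj
  · rintro x (rfl | hx)
    · exact T.mem_of_adj _ _ ha
    · refine SimpleGraph.Reachable.mem_of_forall_adj_mem ?_ hx (mem_of_adj_right ha)
      intro u v huv _
      exact mem_of_adj_right (SimpleGraph.deleteIncidenceSet_adj.1 huv).1
  · rintro z (rfl | hz) hzF
    · exact (hzF (Or.inl rfl)).elim
    · have hzs : z ≠ s := fun h => hzF (Or.inl h)
      have hzV : z ∈ simplexVertices n ∪ T.steiner := by
        refine SimpleGraph.Reachable.mem_of_forall_adj_mem ?_ hz (mem_of_adj_right ha)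
        intro u v huv _
        exact mem_of_adj_right (SimpleGraph.deleteIncidenceSet_adj.1 huv).1
      refine ⟨hzV.resolve_left ?_, fun x hx => ?_⟩
      · rintro ⟨j, rfl⟩
        exact hzF (Or.inr ⟨j, hz, rfl⟩)
      · by_cases hxs : x = s
        · exact Or.inl hxs
        · exact Or.inr (SimpleGraph.Reachable.trans hz (SimpleGraph.Adj.reachable
            (SimpleGraph.deleteIncidenceSet_adj.2 ⟨hx, hzs, hxs⟩)))

theorem exists_direction_eq (hT : T.IsCandidateOptimal) {s a : EuclideanSpace ℝ (Fin n)}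
    (ha : T.graph.Adj s a) : ∃ V : EuclideanSpace ℝ (Fin n), (∀ j, 0 ≤ V j) ∧
      (∀ j, ¬ (T.graph.deleteIncidenceSet s).Reachable a (basisVec j) → V j = 0) ∧
      direction s a = V - (∑ j, V j) • s := by
  obtain ⟨V, hV, hV', h⟩ := exists_sub_eq_of_mem_convexHull (hT.mem_convexHull_branch ha)
  refine ⟨‖a - s‖⁻¹ • V, fun j => ?_, fun j hj => ?_, ?_⟩
  · have := hV j
    simp only [PiLp.smul_apply, smul_eq_mul]
    positivity
  · simp [hV' j hj]
  · rw [direction, h]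
    simp only [PiLp.smul_apply, smul_eq_mul, ← Finset.mul_sum]
    module

/-- The edges at the terminals are longer than `1 / √3`. -/
theorem one_third_lt_norm_sq (hT : T.IsCandidateOptimal) {i : Fin n}
    {s : EuclideanSpace ℝ (Fin n)} (hs : s ∈ T.steiner) (hadj : T.graph.Adj s (basisVec i)) :
    1 / 3 < ‖basisVec i - s‖ ^ 2 := by
  obtain ⟨a, b, ha, hb, hia, hib, hab, -⟩ := hT.exists_neighborSet_eq hs hadj
  obtain ⟨V, hV0, hV, hVa⟩ := hT.exists_direction_eq ha
  obtain ⟨W, hW0, hW, hWb⟩ := hT.exists_direction_eq hb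
  refine one_third_lt_sq_of_directions (norm_basisVec i) ?_ ?_ ?_
    (norm_direction hadj.ne.symm) (norm_direction ha.ne.symm) (norm_direction hb.ne.symm)
    (hT.direction_add_eq_zero hadj ha hb hia hib hab) ?_ hVa hWb
    (Finset.sum_nonneg fun j _ => hV0 j) (Finset.sum_nonneg fun j _ => hW0 j)
    (norm_pos_iff.2 (sub_ne_zero.2 hadj.ne.symm)) (norm_sq_le_sum_sq hV0) (norm_sq_le_sum_sq hW0)
  · rw [inner_basisVec]
    exact hV i fun h => not_reachable_deleteIncidenceSet ha hadj hia.symm h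
  · rw [inner_basisVec]
    exact hW i fun h => not_reachable_deleteIncidenceSet hb hadj hib.symm h
  · rw [PiLp.inner_apply]
    refine Finset.sum_eq_zero fun j _ => ?_
    by_cases h : (T.graph.deleteIncidenceSet s).Reachable a (basisVec j)
    · rw [hW j fun h' => not_reachable_deleteIncidenceSet ha hb hab (h.trans h'.symm)]
      simp
    · rw [hV j h]
      simp
  · rw [norm_smul_direction]
    abel

end SteinerTree.IsCandidateOptimal

/-! ### Fermat points characterized by 120° directions. -/

section Fermat

variable {E : Type*} [NormedAddCommGroup E] [InnerProductSpace ℝ E]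

theorem direction_eq_of_eq_add_smul {v u w : E} {c : ℝ} (hc : 0 < c) (hw : ‖w‖ = 1)
    (h : u = v + c • w) : direction v u = w := by
  rw [direction, h, add_sub_cancel_left, norm_smul, hw, mul_one, Real.norm_eq_abs, abs_of_pos hc,
    inv_smul_smul₀ hc.ne']

theorem direction_swap (u v : E) : direction u v = -direction v u := by
  rw [direction, direction, norm_sub_rev, ← smul_neg, neg_sub]

theorem inner_direction_le_dist {a x : E} (h : a ≠ x) (y : E) :
    inner ℝ (a - y) (direction x a) ≤ dist y a := by
  have := real_inner_le_norm (a - y) (direction x a)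
  rwa [norm_direction h, mul_one, ← dist_eq_norm, dist_comm] at this

/-- Equality in Cauchy–Schwarz puts a - y on the ray of `direction x a`. -/
theorem sub_eq_smul_direction {a x y : E} (h : a ≠ x)
    (heq : inner ℝ (a - y) (direction x a) = dist y a) :
    x - y = (dist y a - dist x a) • direction x a := by
  have h1 : inner ℝ (a - y) (direction x a) = ‖a - y‖ * ‖direction x a‖ := by
    rw [heq, norm_direction h, mul_one, dist_comm, dist_eq_norm]
  rw [inner_eq_norm_mul_iff_real, norm_direction h, one_smul, ← dist_eq_norm, dist_comm] at h1
  have h2 := norm_smul_direction x a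
  rw [← dist_eq_norm, dist_comm] at h2
  rw [sub_smul, ← h1, h2]
  abel

variable {a b c x : E}

/-- Since the directions sum to zero, the sum of the projections onto them does not depend on y. It
calibrates the cost: by `inner_direction_le_dist` it bounds the cost at every y from below. -/
theorem dist_add_dist_add_dist_eq_of_direction (h : direction x a + direction x b + direction x c = 0)
    (y : E) : dist x a + dist x b + dist x c = inner ℝ (a - y) (direction x a) +
      inner ℝ (b - y) (direction x b) + inner ℝ (c - y) (direction x c) := by
  have e : ∀ p : E, dist x p = inner ℝ (p - x) (direction x p) := by
    intro p
    by_cases hp : p = x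
    · simp [hp]
    · rw [← norm_smul_direction x p, real_inner_smul_left, inner_direction_self hp, mul_one,
        dist_comm, dist_eq_norm]
  have h0 : inner ℝ (x - y) (direction x a + direction x b + direction x c) = (0 : ℝ) := by
    rw [h, inner_zero_right]
  have h1 : ∀ p : E, inner ℝ (p - y) (direction x p) =
      (inner ℝ (p - x) (direction x p) + inner ℝ (x - y) (direction x p) : ℝ) := by
    intro p
    rw [← inner_add_left, sub_add_sub_cancel]
  rw [inner_add_right, inner_add_right] at h0
  rw [h1 a, h1 b, h1 c, e a, e b, e c]
  linarith

/-- A point from which the corners of a triangle are seen under angles of 120 degrees is the Fermat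
point. -/
theorem isFermatPoint_of_direction (ha : a ≠ x) (hb : b ≠ x) (hc : c ≠ x)
    (h : direction x a + direction x b + direction x c = 0) : IsFermatPoint a b c x := by
  refine ⟨ha.symm, hb.symm, hc.symm, fun y => ?_⟩
  rw [dist_add_dist_add_dist_eq_of_direction h y]
  have := inner_direction_le_dist ha y
  have := inner_direction_le_dist hb y
  have := inner_direction_le_dist hc y
  linarith

/-- A second minimizer y attains equality in all three projection bounds. Then x - y is a multiple
of two independent directions, hence zero. -/
theorem IsFermatPoint.eq_of_direction {y : E} (hy : IsFermatPoint a b c y) (ha : a ≠ x)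
    (hb : b ≠ x) (hc : c ≠ x) (h : direction x a + direction x b + direction x c = 0) : y = x := by
  have h1 := dist_add_dist_add_dist_eq_of_direction h y
  have h2 := hy.2.2.2 x
  have ea := inner_direction_le_dist ha y
  have eb := inner_direction_le_dist hb y
  have ec := inner_direction_le_dist hc y
  have fa := sub_eq_smul_direction (y := y) ha (by linarith)
  have fb := sub_eq_smul_direction (y := y) hb (by linarith)
  have hab : inner ℝ (direction x a) (direction x b) = -(1 / 2 : ℝ) :=
    inner_eq_of_add_add_eq_zero (norm_direction ha) (norm_direction hb) (norm_direction hc) h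
  have g1 := congrArg (fun v => inner ℝ v (direction x a)) (fa.symm.trans fb)
  have g2 := congrArg (fun v => inner ℝ v (direction x b)) (fa.symm.trans fb)
  simp only [real_inner_smul_left, inner_direction_self ha, inner_direction_self hb, hab,
    real_inner_comm (direction x a) (direction x b)] at g1 g2
  have : dist y a - dist x a = 0 := by linarith
  rw [this, zero_smul, sub_eq_zero] at fa
  exact fa.symm

theorem inner_direction_le_of_mem {u w : E} (ha : a ≠ x) (hb : b ≠ x) (hc : c ≠ x)
    (h : direction x a + direction x b + direction x c = 0) (hu : u ∈ ({a, b, c} : Set E))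
    (hw : w ∈ ({a, b, c} : Set E)) (huw : u ≠ w) :
    inner ℝ (direction x u) (direction x w) ≤ -(1 / 2 : ℝ) := by
  have na := norm_direction ha
  have nb := norm_direction hb
  have nc := norm_direction hc
  have hab := inner_eq_of_add_add_eq_zero na nb nc h
  have hbc := inner_eq_of_add_add_eq_zero nb nc na (by rw [← h]; abel)
  have hac := inner_eq_of_add_add_eq_zero na nc nb (by rw [← h]; abel)
  rcases hu with rfl | rfl | rfl <;> rcases hw with rfl | rfl | rfl <;>
    first
      | exact (huw rfl).elim
      | exact le_of_eq (by assumption)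
      | exact le_of_eq (by rw [real_inner_comm]; assumption)

end Fermat

/-! ### Splitting as a similarity of ratio 1/√2. -/

section Split

variable {n : ℕ}

theorem leftIdx_injective : Function.Injective (leftIdx : Fin n → _) := fun i j h => by
  simp only [leftIdx, Fin.mk.injEq] at h
  exact Fin.ext (by omega)

theorem rightIdx_injective : Function.Injective (rightIdx : Fin n → _) := fun i j h => by
  simp only [rightIdx, Fin.mk.injEq] at h
  exact Fin.ext (by omega)

theorem leftIdx_ne_rightIdx (i j : Fin n) : leftIdx i ≠ rightIdx j := fun h => by
  simp only [leftIdx, rightIdx, Fin.mk.injEq] at h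
  omega

theorem exists_eq_leftIdx_or_rightIdx (j : Fin (2 * n)) :
    ∃ i : Fin n, j = leftIdx i ∨ j = rightIdx i := by
  refine ⟨⟨j.val / 2, by omega⟩, ?_⟩
  simp only [leftIdx, rightIdx, Fin.ext_iff]
  omega

theorem sum_fin_two_mul (f : Fin (2 * n) → ℝ) :
    ∑ j, f j = ∑ i, (f (leftIdx i) + f (rightIdx i)) := by
  have hbij : Function.Bijective (Sum.elim leftIdx rightIdx : Fin n ⊕ Fin n → Fin (2 * n)) := by
    constructor
    · rintro (i | i) (j | j) h
      · exact congrArg Sum.inl (leftIdx_injective h)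
      · exact (leftIdx_ne_rightIdx i j h).elim
      · exact (leftIdx_ne_rightIdx j i h.symm).elim
      · exact congrArg Sum.inr (rightIdx_injective h)
    · intro j
      obtain ⟨i, h | h⟩ := exists_eq_leftIdx_or_rightIdx j
      · exact ⟨Sum.inl i, h.symm⟩
      · exact ⟨Sum.inr i, h.symm⟩
  rw [← Function.Bijective.sum_comp hbij f, Fintype.sum_sum_type, Finset.sum_add_distrib]
  rfl

theorem splitPoint_leftIdx (x : EuclideanSpace ℝ (Fin n)) (i : Fin n) :
    splitPoint x (leftIdx i) = x i / 2 := by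
  have h : (leftIdx i).val / 2 = i.val := by simp [leftIdx]
  change x ⟨(leftIdx i).val / 2, _⟩ / 2 = _
  simp only [h]

theorem splitPoint_rightIdx (x : EuclideanSpace ℝ (Fin n)) (i : Fin n) :
    splitPoint x (rightIdx i) = x i / 2 := by
  have h : (rightIdx i).val / 2 = i.val := by simp only [rightIdx]; omega
  change x ⟨(rightIdx i).val / 2, _⟩ / 2 = _
  simp only [h]

theorem splitPoint_sub (x y : EuclideanSpace ℝ (Fin n)) :
    splitPoint (x - y) = splitPoint x - splitPoint y := by
  ext j
  simp [splitPoint, sub_div]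

theorem splitPoint_smul (c : ℝ) (x : EuclideanSpace ℝ (Fin n)) :
    splitPoint (c • x) = c • splitPoint x := by
  ext j
  simp [splitPoint, mul_div_assoc]

theorem inner_splitPoint (x y : EuclideanSpace ℝ (Fin n)) :
    inner ℝ (splitPoint x) (splitPoint y) = (inner ℝ x y / 2 : ℝ) := by
  rw [PiLp.inner_apply, PiLp.inner_apply, sum_fin_two_mul, Finset.sum_div]
  refine Finset.sum_congr rfl fun i _ => ?_
  simp only [splitPoint_leftIdx, splitPoint_rightIdx, RCLike.inner_apply, conj_trivial]
  ring

theorem norm_splitPoint (x : EuclideanSpace ℝ (Fin n)) :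
    ‖splitPoint x‖ = ‖x‖ / Real.sqrt 2 := by
  rw [← Real.sqrt_sq (norm_nonneg (splitPoint x)), ← real_inner_self_eq_norm_sq, inner_splitPoint,
    real_inner_self_eq_norm_sq, Real.sqrt_div (sq_nonneg _), Real.sqrt_sq (norm_nonneg _)]

theorem splitPoint_injective : Function.Injective (splitPoint : EuclideanSpace ℝ (Fin n) → _) := by
  intro x y h
  ext i
  have := congrArg (fun z : EuclideanSpace ℝ (Fin (2 * n)) => z (leftIdx i)) h
  simp only [splitPoint_leftIdx] at this
  linarith

theorem splitPoint_notMem (x : EuclideanSpace ℝ (Fin n)) :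
    splitPoint x ∉ simplexVertices (2 * n) := by
  rintro ⟨j, hj⟩
  have h1 : ∀ i, splitPoint x (leftIdx i) = splitPoint x (rightIdx i) := fun i => by
    rw [splitPoint_leftIdx, splitPoint_rightIdx]
  obtain ⟨i, rfl | rfl⟩ := exists_eq_leftIdx_or_rightIdx j
  · have := h1 i
    rw [← hj, basisVec_self, basisVec_of_ne (leftIdx_ne_rightIdx i i).symm] at this
    exact one_ne_zero this
  · have := h1 i
    rw [← hj, basisVec_self, basisVec_of_ne (leftIdx_ne_rightIdx i i)] at this
    exact zero_ne_one this

theorem splitPoint_basisVec (i : Fin n) : splitPoint (basisVec i) =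
    (1 / 2 : ℝ) • (basisVec (leftIdx i) + basisVec (rightIdx i)) := by
  ext j
  obtain ⟨k, rfl | rfl⟩ := exists_eq_leftIdx_or_rightIdx j
  · rw [splitPoint_leftIdx]
    simp only [PiLp.smul_apply, PiLp.add_apply, basisVec_apply, leftIdx_injective.eq_iff,
      leftIdx_ne_rightIdx, if_false, smul_eq_mul]
    split_ifs <;> norm_num
  · rw [splitPoint_rightIdx]
    simp only [PiLp.smul_apply, PiLp.add_apply, basisVec_apply, rightIdx_injective.eq_iff,
      (leftIdx_ne_rightIdx _ _).symm, if_false, smul_eq_mul]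
    split_ifs <;> norm_num

theorem direction_splitPoint (v u : EuclideanSpace ℝ (Fin n)) :
    direction (splitPoint v) (splitPoint u) = Real.sqrt 2 • splitPoint (direction v u) := by
  rw [direction, direction, ← splitPoint_sub, norm_splitPoint, splitPoint_smul, smul_smul, inv_div,
    div_eq_mul_inv]

theorem inner_direction_splitPoint (v u w : EuclideanSpace ℝ (Fin n)) :
    inner ℝ (direction (splitPoint v) (splitPoint u)) (direction (splitPoint v) (splitPoint w)) =
      (inner ℝ (direction v u) (direction v w) : ℝ) := by
  have h2 : Real.sqrt 2 * Real.sqrt 2 = 2 := Real.mul_self_sqrt zero_le_two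
  rw [direction_splitPoint, direction_splitPoint, real_inner_smul_left, real_inner_smul_right,
    inner_splitPoint, ← mul_assoc, h2]
  ring

end Split

/-! ### The Fermat point as the split of a retracted terminal. -/

section Retract

variable {n : ℕ}

/-- The point at distance `1 / √3` from the vertex `e i` on the way to `s`. -/
noncomputable def retractPoint (i : Fin n) (s : EuclideanSpace ℝ (Fin n)) :
    EuclideanSpace ℝ (Fin n) :=
  basisVec i + (Real.sqrt 3)⁻¹ • direction (basisVec i) s

variable {i : Fin n} {s : EuclideanSpace ℝ (Fin n)}

theorem retractPoint_eq (i : Fin n) (s : EuclideanSpace ℝ (Fin n)) : retractPoint i s =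
    s + (‖basisVec i - s‖ - (Real.sqrt 3)⁻¹) • direction s (basisVec i) := by
  rw [retractPoint, direction_swap, sub_smul, norm_smul_direction]
  module

theorem inv_sqrt_three_lt (h : 1 / 3 < ‖basisVec i - s‖ ^ 2) :
    (Real.sqrt 3)⁻¹ < ‖basisVec i - s‖ := by
  refine lt_of_pow_lt_pow_left₀ 2 (norm_nonneg _) ?_
  rw [inv_pow, Real.sq_sqrt (by norm_num)]
  simpa using h

theorem ne_of_one_third_lt (h : 1 / 3 < ‖basisVec i - s‖ ^ 2) : basisVec i ≠ s := by
  rintro rfl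
  norm_num at h

theorem direction_retractPoint (h : 1 / 3 < ‖basisVec i - s‖ ^ 2) :
    direction s (retractPoint i s) = direction s (basisVec i) :=
  direction_eq_of_eq_add_smul (sub_pos.2 (inv_sqrt_three_lt h))
    (norm_direction (ne_of_one_third_lt h)) (retractPoint_eq i s)

theorem retractPoint_ne (h : 1 / 3 < ‖basisVec i - s‖ ^ 2) : retractPoint i s ≠ s := by
  rw [retractPoint_eq, Ne, add_eq_left, smul_eq_zero, not_or]
  refine ⟨(sub_pos.2 (inv_sqrt_three_lt h)).ne', fun h0 => ?_⟩
  have := norm_direction (ne_of_one_third_lt h)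
  rw [h0, norm_zero] at this
  exact zero_ne_one this

theorem dist_basisVec_retractPoint (h : 1 / 3 < ‖basisVec i - s‖ ^ 2) :
    dist (basisVec i) (retractPoint i s) = (Real.sqrt 3)⁻¹ := by
  rw [retractPoint, dist_self_add_right, norm_smul, norm_direction (ne_of_one_third_lt h).symm,
    mul_one, Real.norm_eq_abs, abs_of_pos (by positivity)]

theorem inner_basisVec_sub_splitPoint (i : Fin n) (x : EuclideanSpace ℝ (Fin n)) :
    inner ℝ (basisVec (leftIdx i) - basisVec (rightIdx i)) (splitPoint x) = (0 : ℝ) := by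
  rw [inner_sub_left, inner_basisVec, inner_basisVec, splitPoint_leftIdx, splitPoint_rightIdx,
    sub_self]

/-- The vectors e_left - e_right and the split of D are orthogonal, of lengths √2 and 1/√2. The two
components thus have lengths √3/2 and 1/2, the sine and cosine of 60°; the sign ε selects one of the
two terminals. -/
theorem norm_direction_aux (D : EuclideanSpace ℝ (Fin n)) (hD : ‖D‖ = 1) (ε : ℝ) (hε : ε ^ 2 = 1) :
    ‖(ε * (3 / 4 * (Real.sqrt 3)⁻¹ * Real.sqrt 2)) •
      (basisVec (leftIdx i) - basisVec (rightIdx i)) +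
        (1 / 2 * Real.sqrt 2) • splitPoint D‖ = 1 := by
  have h2 : Real.sqrt 2 ^ 2 = 2 := Real.sq_sqrt zero_le_two
  have h3 : (Real.sqrt 3)⁻¹ ^ 2 = 1 / 3 := by
    rw [inv_pow, Real.sq_sqrt (by norm_num)]; norm_num
  rw [← sq_eq_sq₀ (norm_nonneg _) zero_le_one, norm_add_sq_real, real_inner_smul_left,
    real_inner_smul_right, inner_basisVec_sub_splitPoint, norm_smul, norm_smul, mul_pow, mul_pow,
    Real.norm_eq_abs, Real.norm_eq_abs, sq_abs, sq_abs, ← real_inner_self_eq_norm_sq (splitPoint D),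
    inner_splitPoint, real_inner_self_eq_norm_sq, hD, norm_sub_sq_real, norm_basisVec,
    norm_basisVec, inner_basisVec, basisVec_of_ne (leftIdx_ne_rightIdx i i)]
  simp only [mul_pow, h2, h3, hε]
  norm_num

/-- From the split of the retracted vertex, the corners of the triangle of the doubling procedure
are seen under angles of 120 degrees. -/
theorem direction_splitPoint_retractPoint (h : 1 / 3 < ‖basisVec i - s‖ ^ 2) :
    direction (splitPoint (retractPoint i s)) (basisVec (leftIdx i)) +
      direction (splitPoint (retractPoint i s)) (basisVec (rightIdx i)) +
      direction (splitPoint (retractPoint i s)) (splitPoint s) = 0 := by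
  set D := direction s (basisVec i) with hD
  have hDn : ‖D‖ = 1 := norm_direction (ne_of_one_third_lt h)
  have hx : splitPoint (retractPoint i s) =
      (1 / 2 : ℝ) • (basisVec (leftIdx i) + basisVec (rightIdx i)) -
        (Real.sqrt 3)⁻¹ • splitPoint D := by
    have : retractPoint i s = basisVec i - (Real.sqrt 3)⁻¹ • D := by
      rw [retractPoint, direction_swap]; module
    rw [this, splitPoint_sub, splitPoint_smul, splitPoint_basisVec]
  have h2 : Real.sqrt 2 * Real.sqrt 2 = 2 := Real.mul_self_sqrt zero_le_two
  have h3 : (Real.sqrt 3)⁻¹ * (Real.sqrt 3)⁻¹ = 1 / 3 := by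
    rw [← mul_inv, Real.mul_self_sqrt (by norm_num)]; norm_num
  -- This constant √2/√3 is the distance from the Fermat point to either new terminal: half the side
  -- √2 divided by sin 60°.
  have hc : 0 < (Real.sqrt 3)⁻¹ * Real.sqrt 2 := by positivity
  have c1 : (Real.sqrt 3)⁻¹ * Real.sqrt 2 * (3 / 4 * (Real.sqrt 3)⁻¹ * Real.sqrt 2) = 1 / 2 := by
    linear_combination (3 / 4 * (Real.sqrt 3)⁻¹ * (Real.sqrt 3)⁻¹) * h2 + 3 / 2 * h3
  have c2 : (Real.sqrt 3)⁻¹ * Real.sqrt 2 * (1 / 2 * Real.sqrt 2) = (Real.sqrt 3)⁻¹ := by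
    linear_combination (1 / 2 * (Real.sqrt 3)⁻¹) * h2
  have ha := direction_eq_of_eq_add_smul (v := splitPoint (retractPoint i s))
    (u := basisVec (leftIdx i)) hc (norm_direction_aux (i := i) D hDn 1 (by norm_num)) (by
      rw [hx, smul_add (_ * _), smul_smul, smul_smul, c2, one_mul, c1]
      module)
  have hb := direction_eq_of_eq_add_smul (v := splitPoint (retractPoint i s))
    (u := basisVec (rightIdx i)) hc (norm_direction_aux (i := i) D hDn (-1) (by norm_num)) (by
      rw [hx, smul_add (_ * _), smul_smul, smul_smul, c2, mul_left_comm, c1]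
      module)
  have hcc : direction (splitPoint (retractPoint i s)) (splitPoint s) =
      -(Real.sqrt 2 • splitPoint D) := by
    rw [direction_swap, direction_splitPoint, direction_retractPoint h]
  rw [ha, hb, hcc]
  module

theorem basisVec_ne_splitPoint (j : Fin (2 * n)) (x : EuclideanSpace ℝ (Fin n)) :
    basisVec j ≠ splitPoint x :=
  fun h => splitPoint_notMem x (h ▸ basisVec_mem j)

theorem isFermatPoint_iff_eq (h : 1 / 3 < ‖basisVec i - s‖ ^ 2)
    {x : EuclideanSpace ℝ (Fin (2 * n))} :
    IsFermatPoint (basisVec (leftIdx i)) (basisVec (rightIdx i)) (splitPoint s) x ↔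
      x = splitPoint (retractPoint i s) := by
  have ha := basisVec_ne_splitPoint (leftIdx i) (retractPoint i s)
  have hb := basisVec_ne_splitPoint (rightIdx i) (retractPoint i s)
  have hc : splitPoint s ≠ splitPoint (retractPoint i s) :=
    splitPoint_injective.ne (retractPoint_ne h).symm
  constructor
  · exact fun hx => hx.eq_of_direction ha hb hc (direction_splitPoint_retractPoint h)
  · rintro rfl
    exact isFermatPoint_of_direction ha hb hc (direction_splitPoint_retractPoint h)

end Retract

/-! ### Recognizing trees by counting edges. -/

namespace SimpleGraph

variable {V : Type*} {G : SimpleGraph V} {s : Set V}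

theorem card_edgeSet_induce (h : ∀ u v, G.Adj u v → u ∈ s) :
    Nat.card (G.induce s).edgeSet = G.edgeSet.ncard := by
  rw [Nat.card_coe_set_eq,
    ← Set.ncard_image_of_injective _ (Sym2.map.injective Subtype.val_injective)]
  congr 1
  ext e
  constructor
  · rintro ⟨e', he', rfl⟩
    induction e' with
    | h u v => exact he'
  · induction e with
    | h u v =>
      intro huv
      exact ⟨s(⟨u, h u v huv⟩, ⟨v, h v u (SimpleGraph.Adj.symm huv)⟩), huv, rfl⟩

/-- A connected graph has at least |s| - 1 edges anyway, so for the doubled graph an upper bound on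
the number of edges suffices. -/
theorem isTree_induce_of_ncard_le (hfin : s.Finite) (hs : s.Nonempty)
    (h : ∀ u v, G.Adj u v → u ∈ s) (hr : ∀ x ∈ s, ∀ y ∈ s, G.Reachable x y)
    (hcard : G.edgeSet.ncard + 1 ≤ s.ncard) : (G.induce s).IsTree := by
  have : Finite s := hfin
  have hc := connected_induce_of_forall_reachable hs h hr
  refine isTree_iff_connected_and_card.2 ⟨hc, le_antisymm ?_ ?_⟩
  · rwa [card_edgeSet_induce h, Nat.card_coe_set_eq]
  · exact hc.card_vert_le_card_edgeSet_add_one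

end SimpleGraph

theorem SteinerTree.ncard_edgeSet_add_one {E : Type*} [MetricSpace E] {P : Set E}
    (T : SteinerTree P) : T.graph.edgeSet.ncard + 1 = (P ∪ T.steiner).ncard := by
  have : Finite ↥(P ∪ T.steiner) := T.finite_verts
  rw [← SimpleGraph.card_edgeSet_induce T.mem_of_adj,
    (SimpleGraph.isTree_iff_connected_and_card.1 T.isTree).2, Nat.card_coe_set_eq]

/-! ### The vertex map from a tree to its double, its injectivity and its angles. -/

section RetractTerminals

variable {n : ℕ}

open Classical in
/-- Replaces each vertex `e i` of the simplex by its retraction towards `s i`. -/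
noncomputable def retractTerminals (s : Fin n → EuclideanSpace ℝ (Fin n))
    (z : EuclideanSpace ℝ (Fin n)) : EuclideanSpace ℝ (Fin n) :=
  if h : ∃ i, basisVec i = z then retractPoint h.choose (s h.choose) else z

variable (s : Fin n → EuclideanSpace ℝ (Fin n))

theorem retractTerminals_basisVec (i : Fin n) :
    retractTerminals s (basisVec i) = retractPoint i (s i) := by
  have h : ∃ j : Fin n, basisVec j = basisVec i := ⟨i, rfl⟩
  rw [retractTerminals, dif_pos h, basisVec_injective h.choose_spec]

theorem retractTerminals_of_notMem {z : EuclideanSpace ℝ (Fin n)} (h : z ∉ simplexVertices n) :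
    retractTerminals s z = z :=
  dif_neg h

/-- The point of the doubled tree that corresponds to a vertex of the original tree. -/
noncomputable def doublePoint (z : EuclideanSpace ℝ (Fin n)) : EuclideanSpace ℝ (Fin (2 * n)) :=
  splitPoint (retractTerminals s z)

theorem doublePoint_basisVec (i : Fin n) :
    doublePoint s (basisVec i) = splitPoint (retractPoint i (s i)) := by
  rw [doublePoint, retractTerminals_basisVec]

theorem doublePoint_of_notMem {z : EuclideanSpace ℝ (Fin n)} (h : z ∉ simplexVertices n) :
    doublePoint s z = splitPoint z := by
  rw [doublePoint, retractTerminals_of_notMem s h]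

/-- The edges of the doubled tree. -/
def doubledEdges (T : SimplexSteinerTree n) (s : Fin n → EuclideanSpace ℝ (Fin n))
    (x : Fin n → EuclideanSpace ℝ (Fin (2 * n))) : Set (Sym2 (EuclideanSpace ℝ (Fin (2 * n)))) :=
  {e | ∃ r ∈ T.steiner, ∃ t ∈ T.steiner, T.graph.Adj r t ∧
      e = s(splitPoint r, splitPoint t)} ∪
    {e | ∃ i, e = s(basisVec (leftIdx i), x i) ∨ e = s(basisVec (rightIdx i), x i) ∨
      e = s(x i, splitPoint (s i))}

/-- Two points joined by a leaf edge of the doubled tree, the first one being the terminal. -/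
def IsLeafEdge (s : Fin n → EuclideanSpace ℝ (Fin n)) (u v : EuclideanSpace ℝ (Fin (2 * n))) :
    Prop :=
  ∃ i, v = doublePoint s (basisVec i) ∧ (u = basisVec (leftIdx i) ∨ u = basisVec (rightIdx i))

end RetractTerminals

namespace SteinerTree.IsCandidateOptimal

variable {n : ℕ} {T : SimplexSteinerTree n} {s : Fin n → EuclideanSpace ℝ (Fin n)}

theorem one_third_lt (hT : T.IsCandidateOptimal)
    (hs : ∀ i, s i ∈ T.steiner ∧ T.graph.neighborSet (basisVec i) = {s i}) (i : Fin n) :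
    1 / 3 < ‖basisVec i - s i‖ ^ 2 := by
  have h : s i ∈ T.graph.neighborSet (basisVec i) := by rw [(hs i).2]; rfl
  exact hT.one_third_lt_norm_sq (hs i).1 (SimpleGraph.Adj.symm h)

/-- No Steiner point is further in the direction of a terminal than the one adjacent to it. -/
theorem apply_le_apply (hT : T.IsCandidateOptimal) (hn : 3 ≤ n)
    (hs : ∀ i, s i ∈ T.steiner ∧ T.graph.neighborSet (basisVec i) = {s i}) (i : Fin n)
    {t : EuclideanSpace ℝ (Fin n)} (ht : t ∈ T.steiner) : t i ≤ s i i := by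
  -- Maximum principle on the tree without the leaf e_i: the boundary is s_i with the other
  -- terminals, where coordinate i vanishes.
  have hsub : ({x | x ≠ basisVec i} ∩ (simplexVertices n ∪ T.steiner)) ⊆ convexHull ℝ
      (insert (s i) ({x | x ≠ basisVec i} ∩ simplexVertices n)) := by
    refine hT.subset_convexHull_of_steiner ?_ Set.inter_subset_right ⟨s i, Or.inl rfl⟩ ?_
    · rintro x (rfl | ⟨hx, hx'⟩)
      · exact ⟨fun h => notMem_of_mem_steiner (hs i).1 (h ▸ basisVec_mem i), Or.inr (hs i).1⟩
      · exact ⟨hx, Or.inl hx'⟩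
    · rintro z ⟨hz, hz'⟩ hzF
      refine ⟨hz'.resolve_left fun h => hzF (Or.inr ⟨hz, h⟩), fun x hx => ⟨?_, mem_of_adj_right hx⟩⟩
      rintro rfl
      have : z ∈ T.graph.neighborSet (basisVec i) := hx.symm
      rw [(hs i).2] at this
      exact hzF (Or.inl this)
  have hconv : Convex ℝ {x : EuclideanSpace ℝ (Fin n) | x i ≤ s i i} := by
    intro x hx y hy a b ha hb hab
    have h1 := mul_le_mul_of_nonneg_left (show x i ≤ s i i from hx) ha
    have h2 := mul_le_mul_of_nonneg_left (show y i ≤ s i i from hy) hb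
    simp only [Set.mem_ofPred_eq, PiLp.add_apply, PiLp.smul_apply, smul_eq_mul]
    calc a * x i + b * y i ≤ (a + b) * s i i := by linarith
      _ = s i i := by rw [hab, one_mul]
  refine convexHull_min ?_ hconv
    (hsub ⟨fun h => notMem_of_mem_steiner ht (h ▸ basisVec_mem i), Or.inr ht⟩)
  rintro x (rfl | ⟨hx, j, rfl⟩)
  · exact le_refl (s i i)
  · have hji : i ≠ j := fun h => hx (by rw [h])
    change basisVec j i ≤ s i i
    rw [basisVec_of_ne hji]
    exact (hT.mem_simplex hn (Or.inr (hs i).1)).1 i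

/-- Together with `apply_le_apply`, this keeps the retracted terminal apart from every Steiner
point. -/
theorem apply_lt_retractPoint (hT : T.IsCandidateOptimal) (hn : 3 ≤ n)
    (hs : ∀ i, s i ∈ T.steiner ∧ T.graph.neighborSet (basisVec i) = {s i}) (i : Fin n) :
    s i i < retractPoint i (s i) i := by
  have h := hT.one_third_lt hs i
  have h1 := inv_sqrt_three_lt h
  have h2 := hT.apply_lt_one hn (hs i).1 i
  have h3 : 0 < ‖basisVec i - s i‖⁻¹ := inv_pos.2 (lt_trans (by positivity) h1)
  rw [retractPoint_eq]
  simp only [direction, PiLp.add_apply, PiLp.smul_apply, PiLp.sub_apply, smul_eq_mul, basisVec_self]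
  have := mul_pos (sub_pos.2 h1) (mul_pos h3 (sub_pos.2 h2))
  linarith

theorem injOn_retractTerminals (hT : T.IsCandidateOptimal) (hn : 3 ≤ n)
    (hs : ∀ i, s i ∈ T.steiner ∧ T.graph.neighborSet (basisVec i) = {s i}) :
    Set.InjOn (retractTerminals s) (simplexVertices n ∪ T.steiner) := by
  have hne : ∀ i, ∀ t ∈ T.steiner, retractPoint i (s i) ≠ t := by
    rintro i t ht rfl
    have h1 := hT.apply_lt_retractPoint hn hs i
    have h2 := hT.apply_le_apply hn hs i ht
    linarith
  rintro x (⟨i, rfl⟩ | hx) y (⟨j, rfl⟩ | hy) hxy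
  · by_contra hij
    have hij' : i ≠ j := fun h => hij (by rw [h])
    rw [retractTerminals_basisVec, retractTerminals_basisVec] at hxy
    -- Coinciding retractions of two terminals would give √2 ≤ 2/√3, that is 2 ≤ 4/3.
    have h := dist_triangle (basisVec i) (retractPoint i (s i)) (basisVec j)
    have h1 := dist_basisVec_retractPoint (hT.one_third_lt hs i)
    have h2 := dist_basisVec_retractPoint (hT.one_third_lt hs j)
    rw [dist_basisVec hij', h1, hxy, dist_comm _ (basisVec j), h2] at h
    have e2 : Real.sqrt 2 ^ 2 = 2 := Real.sq_sqrt zero_le_two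
    have e3 : (Real.sqrt 3)⁻¹ ^ 2 = 1 / 3 := by
      rw [inv_pow, Real.sq_sqrt (by norm_num)]; norm_num
    have e4 := pow_le_pow_left₀ (Real.sqrt_nonneg 2) h 2
    rw [e2, ← two_mul, mul_pow, e3] at e4
    norm_num at e4
  · rw [retractTerminals_basisVec, retractTerminals_of_notMem s (notMem_of_mem_steiner hy)] at hxy
    exact (hne i y hy hxy).elim
  · rw [retractTerminals_basisVec, retractTerminals_of_notMem s (notMem_of_mem_steiner hx)] at hxy
    exact (hne j x hx hxy.symm).elim
  · rwa [retractTerminals_of_notMem s (notMem_of_mem_steiner hx),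
      retractTerminals_of_notMem s (notMem_of_mem_steiner hy)] at hxy

theorem injOn_doublePoint (hT : T.IsCandidateOptimal) (hn : 3 ≤ n)
    (hs : ∀ i, s i ∈ T.steiner ∧ T.graph.neighborSet (basisVec i) = {s i}) :
    Set.InjOn (doublePoint s) (simplexVertices n ∪ T.steiner) :=
  splitPoint_injective.comp_injOn (hT.injOn_retractTerminals hn hs)

/-- Retraction moves a terminal along its edge and so keeps the direction from z; splitting
preserves inner products of directions. -/
theorem inner_direction_doublePoint_le (hT : T.IsCandidateOptimal)
    (hs : ∀ i, s i ∈ T.steiner ∧ T.graph.neighborSet (basisVec i) = {s i})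
    {z p q : EuclideanSpace ℝ (Fin n)} (hz : z ∈ T.steiner) (hp : T.graph.Adj z p)
    (hq : T.graph.Adj z q) (hpq : p ≠ q) :
    inner ℝ (direction (doublePoint s z) (doublePoint s p))
      (direction (doublePoint s z) (doublePoint s q)) ≤ -(1 / 2 : ℝ) := by
  have key : ∀ p, T.graph.Adj z p → direction z (retractTerminals s p) = direction z p := by
    intro p hp
    rcases mem_of_adj_right hp with ⟨i, rfl⟩ | h
    · have : z ∈ T.graph.neighborSet (basisVec i) := hp.symm
      rw [(hs i).2] at this
      rw [retractTerminals_basisVec, Set.mem_singleton_iff.1 this]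
      exact direction_retractPoint (hT.one_third_lt hs i)
    · rw [retractTerminals_of_notMem s (notMem_of_mem_steiner h)]
  rw [doublePoint, doublePoint, doublePoint, inner_direction_splitPoint,
    retractTerminals_of_notMem s (notMem_of_mem_steiner hz), key p hp, key q hq]
  exact hT.inner_direction_le hp hq hpq

end SteinerTree.IsCandidateOptimal

/-! ### The doubling procedure: existence, uniqueness, candidate-optimality. -/

namespace SteinerTree

variable {n : ℕ} {T : SimplexSteinerTree n} {s : Fin n → EuclideanSpace ℝ (Fin n)}

/-- The edge from x_i to s_i' is the image of the terminal edge e_i s_i, so the doubled tree is an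
image of the whole tree with two leaf edges attached at each x_i. -/
theorem mem_doubledEdges_iff
    (hs : ∀ i, s i ∈ T.steiner ∧ T.graph.neighborSet (basisVec i) = {s i})
    (u v : EuclideanSpace ℝ (Fin (2 * n))) :
    s(u, v) ∈ doubledEdges T s (fun i => splitPoint (retractPoint i (s i))) ↔
      (∃ p q, T.graph.Adj p q ∧ u = doublePoint s p ∧ v = doublePoint s q) ∨
        IsLeafEdge s u v ∨ IsLeafEdge s v u := by
  have hst : ∀ t ∈ T.steiner, doublePoint s t = splitPoint t :=
    fun t ht => doublePoint_of_notMem s (notMem_of_mem_steiner ht)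
  have hadj : ∀ i, T.graph.Adj (basisVec i) (s i) := fun i => by
    have h : s i ∈ T.graph.neighborSet (basisVec i) := by rw [(hs i).2]; rfl
    exact h
  simp only [doubledEdges, IsLeafEdge, Set.mem_union, Set.mem_ofPred_eq, Sym2.eq_iff,
    ← doublePoint_basisVec]
  constructor
  · rintro (⟨r, hr, t, ht, hrt, ⟨rfl, rfl⟩ | ⟨rfl, rfl⟩⟩ |
      ⟨i, (⟨rfl, rfl⟩ | ⟨rfl, rfl⟩) | (⟨rfl, rfl⟩ | ⟨rfl, rfl⟩) | (⟨rfl, rfl⟩ | ⟨rfl, rfl⟩)⟩)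
    · exact Or.inl ⟨r, t, hrt, (hst r hr).symm, (hst t ht).symm⟩
    · exact Or.inl ⟨t, r, hrt.symm, (hst t ht).symm, (hst r hr).symm⟩
    · exact Or.inr (Or.inl ⟨i, rfl, Or.inl rfl⟩)
    · exact Or.inr (Or.inr ⟨i, rfl, Or.inl rfl⟩)
    · exact Or.inr (Or.inl ⟨i, rfl, Or.inr rfl⟩)
    · exact Or.inr (Or.inr ⟨i, rfl, Or.inr rfl⟩)
    · exact Or.inl ⟨_, _, hadj i, rfl, (hst _ (hs i).1).symm⟩
    · exact Or.inl ⟨_, _, (hadj i).symm, (hst _ (hs i).1).symm, rfl⟩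
  · rintro (⟨p, q, hpq, rfl, rfl⟩ | ⟨i, rfl, rfl | rfl⟩ | ⟨i, rfl, rfl | rfl⟩)
    · have hterm : ∀ i q, T.graph.Adj (basisVec i) q → q = s i := fun i q h => by
        have : q ∈ T.graph.neighborSet (basisVec i) := h
        rwa [(hs i).2] at this
      rcases T.mem_of_adj _ _ hpq with ⟨i, rfl⟩ | hp
      · obtain rfl := hterm i q hpq
        exact Or.inr ⟨i, Or.inr (Or.inr (Or.inl ⟨rfl, hst _ (hs i).1⟩))⟩
      · rcases mem_of_adj_right hpq with ⟨i, rfl⟩ | hq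
        · obtain rfl := hterm i p hpq.symm
          exact Or.inr ⟨i, Or.inr (Or.inr (Or.inr ⟨hst _ (hs i).1, rfl⟩))⟩
        · exact Or.inl ⟨p, hp, q, hq, hpq, Or.inl ⟨hst p hp, hst q hq⟩⟩
    · exact Or.inr ⟨i, Or.inl (Or.inl ⟨rfl, rfl⟩)⟩
    · exact Or.inr ⟨i, Or.inr (Or.inl (Or.inl ⟨rfl, rfl⟩))⟩
    · exact Or.inr ⟨i, Or.inl (Or.inr ⟨rfl, rfl⟩)⟩
    · exact Or.inr ⟨i, Or.inr (Or.inl (Or.inr ⟨rfl, rfl⟩))⟩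

theorem splitPoint_image_union_range_eq (T : SimplexSteinerTree n)
    (s : Fin n → EuclideanSpace ℝ (Fin n)) :
    splitPoint '' T.steiner ∪ Set.range (fun i => splitPoint (retractPoint i (s i))) =
      doublePoint s '' (simplexVertices n ∪ T.steiner) := by
  have h : doublePoint s '' simplexVertices n =
      Set.range (fun i => splitPoint (retractPoint i (s i))) := by
    rw [simplexVertices, ← Set.range_comp]
    exact congrArg Set.range (funext fun i => doublePoint_basisVec s i)
  rw [Set.image_union, Set.union_comm, h]
  congr 1
  exact Set.image_congr fun t ht => (doublePoint_of_notMem s (notMem_of_mem_steiner ht)).symm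

theorem ncard_doubledEdges_le
    (hs : ∀ i, s i ∈ T.steiner ∧ T.graph.neighborSet (basisVec i) = {s i}) :
    (doubledEdges T s (fun i => splitPoint (retractPoint i (s i)))).ncard ≤
      T.graph.edgeSet.ncard + 2 * n := by
  set R : Set (Sym2 (EuclideanSpace ℝ (Fin (2 * n)))) := Set.range fun j : Fin (2 * n) =>
    s(basisVec j, doublePoint s (basisVec ⟨j.val / 2, by omega⟩))
  have hsub : doubledEdges T s (fun i => splitPoint (retractPoint i (s i))) ⊆
      Sym2.map (doublePoint s) '' T.graph.edgeSet ∪ R := by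
    have hleaf : ∀ u v, IsLeafEdge s u v → s(u, v) ∈ R := by
      rintro u v ⟨i, rfl, rfl | rfl⟩
      · refine ⟨leftIdx i, ?_⟩
        have h : (leftIdx i).val / 2 = i.val := by simp [leftIdx]
        simp only [h]
      · refine ⟨rightIdx i, ?_⟩
        have h : (rightIdx i).val / 2 = i.val := by simp only [rightIdx]; omega
        simp only [h]
    intro e he
    induction e with
    | h u v =>
      rcases (mem_doubledEdges_iff hs u v).1 he with ⟨p, q, hpq, rfl, rfl⟩ | h | h
      · exact Or.inl ⟨s(p, q), hpq, rfl⟩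
      · exact Or.inr (hleaf u v h)
      · exact Or.inr (Sym2.eq_swap ▸ hleaf v u h)
  have hR : R.ncard ≤ 2 * n := by
    have h := Set.ncard_image_le (s := (Set.univ : Set (Fin (2 * n)))) (f := fun j =>
      s(basisVec j, doublePoint s (basisVec (⟨j.val / 2, by omega⟩ : Fin n)))) (Set.toFinite _)
    rwa [Set.image_univ, Set.ncard_univ, Nat.card_eq_fintype_card, Fintype.card_fin] at h
  calc _ ≤ (Sym2.map (doublePoint s) '' T.graph.edgeSet ∪ R).ncard :=
        Set.ncard_le_ncard hsub ((T.finite_edgeSet.image _).union (Set.finite_range _))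
    _ ≤ (Sym2.map (doublePoint s) '' T.graph.edgeSet).ncard + R.ncard := Set.ncard_union_le _ _
    _ ≤ T.graph.edgeSet.ncard + 2 * n := add_le_add (Set.ncard_image_le T.finite_edgeSet) hR

theorem disjoint_doublePoint (T : SimplexSteinerTree n) (s : Fin n → EuclideanSpace ℝ (Fin n)) :
    Disjoint (simplexVertices (2 * n)) (doublePoint s '' (simplexVertices n ∪ T.steiner)) := by
  rw [Set.disjoint_left]
  rintro _ hx ⟨z, -, rfl⟩
  exact splitPoint_notMem _ hx

namespace IsCandidateOptimal

/-- The doubling procedure can be carried out. -/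
theorem exists_isDoubling (hT : T.IsCandidateOptimal) (hn : 3 ≤ n) :
    ∃ T' : SimplexSteinerTree (2 * n), IsDoubling T T' := by
  choose s hs using hT.exists_neighborSet_basisVec hn
  set D := doubledEdges T s (fun i => splitPoint (retractPoint i (s i))) with hD
  set V := simplexVertices n ∪ T.steiner with hV
  set V' := simplexVertices (2 * n) ∪ doublePoint s '' V with hV'
  have hinj := hT.injOn_doublePoint hn hs
  have hDne : ∀ u v, s(u, v) ∈ D → u ≠ v := by
    intro u v huv
    rcases (mem_doubledEdges_iff hs u v).1 huv with ⟨p, q, hpq, rfl, rfl⟩ |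
      ⟨i, rfl, rfl | rfl⟩ | ⟨i, rfl, rfl | rfl⟩
    · exact hinj.ne (T.mem_of_adj _ _ hpq) (mem_of_adj_right hpq) hpq.ne
    · exact basisVec_ne_splitPoint _ _
    · exact basisVec_ne_splitPoint _ _
    · exact (basisVec_ne_splitPoint _ _).symm
    · exact (basisVec_ne_splitPoint _ _).symm
  set G := SimpleGraph.fromEdgeSet D with hG
  have hadj : ∀ u v, G.Adj u v ↔ s(u, v) ∈ D := fun u v => by
    rw [hG, SimpleGraph.fromEdgeSet_adj]
    exact ⟨fun h => h.1, fun h => ⟨h, hDne u v h⟩⟩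
  have hedge : G.edgeSet = D := by
    ext e
    induction e with
    | h u v => exact hadj u v
  have hmem : ∀ u v, G.Adj u v → u ∈ V' := by
    intro u v huv
    rcases (mem_doubledEdges_iff hs u v).1 ((hadj u v).1 huv) with ⟨p, q, hpq, rfl, rfl⟩ |
      ⟨i, rfl, rfl | rfl⟩ | ⟨i, rfl, -⟩
    · exact Or.inr ⟨p, T.mem_of_adj _ _ hpq, rfl⟩
    · exact Or.inl (basisVec_mem _)
    · exact Or.inl (basisVec_mem _)
    · exact Or.inr ⟨_, Or.inl (basisVec_mem i), rfl⟩
  have hfin : V'.Finite := (Set.finite_range _).union (T.finite_verts.image _)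
  have hto : ∀ x ∈ V', ∃ z ∈ V, G.Reachable x (doublePoint s z) := by
    rintro x (⟨j, rfl⟩ | ⟨z, hz, rfl⟩)
    · obtain ⟨i, hi⟩ := exists_eq_leftIdx_or_rightIdx j
      refine ⟨basisVec i, Or.inl (basisVec_mem i), SimpleGraph.Adj.reachable ?_⟩
      rw [hadj, hD, mem_doubledEdges_iff hs]
      exact Or.inr (Or.inl ⟨i, rfl, hi.imp (congrArg _) (congrArg _)⟩)
    · exact ⟨z, hz, SimpleGraph.Reachable.refl _⟩
  have hreach : ∀ x ∈ V', ∀ y ∈ V', G.Reachable x y := by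
    intro x hx y hy
    obtain ⟨z, hz, hxz⟩ := hto x hx
    obtain ⟨w, hw, hyw⟩ := hto y hy
    refine hxz.trans (SimpleGraph.Reachable.trans ?_ hyw.symm)
    refine (T.reachable hz hw).of_forall_adj (doublePoint s) fun p q hpq => ?_
    refine SimpleGraph.Adj.reachable ?_
    rw [hadj, hD, mem_doubledEdges_iff hs]
    exact Or.inl ⟨p, q, hpq, rfl, rfl⟩
  -- Doubling adds 2n vertices, the new terminals, and at most 2n edges; the rest is the edge count
  -- of the original tree.
  have hcard : G.edgeSet.ncard + 1 ≤ V'.ncard := by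
    rw [hedge, hV', Set.ncard_union_eq (disjoint_doublePoint T s) (Set.finite_range _)
      (T.finite_verts.image _), hinj.ncard_image, ncard_simplexVertices,
      ← T.ncard_edgeSet_add_one]
    have : D.ncard ≤ _ := ncard_doubledEdges_le hs
    omega
  let T' : SimplexSteinerTree (2 * n) :=
    { steiner := doublePoint s '' V
      graph := G
      finite_verts := hfin
      disjoint := disjoint_doublePoint T s
      mem_of_adj := hmem
      isTree := SimpleGraph.isTree_induce_of_ncard_le hfin
        ((simplexVertices_nonempty (n := 2 * n) (by omega)).mono Set.subset_union_left)
        hmem hreach hcard }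
  exact ⟨T', s, fun i => splitPoint (retractPoint i (s i)), hs,
    fun i => (isFermatPoint_iff_eq (hT.one_third_lt hs i)).2 rfl,
    (splitPoint_image_union_range_eq T s).symm, hedge⟩

/-- The result of the doubling procedure, with the Fermat points given explicitly. -/
theorem exists_of_isDoubling (hT : T.IsCandidateOptimal) {T' : SimplexSteinerTree (2 * n)}
    (h : IsDoubling T T') : ∃ s : Fin n → EuclideanSpace ℝ (Fin n),
      (∀ i, s i ∈ T.steiner ∧ T.graph.neighborSet (basisVec i) = {s i}) ∧
      T'.steiner = doublePoint s '' (simplexVertices n ∪ T.steiner) ∧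
      T'.graph.edgeSet = doubledEdges T s (fun i => splitPoint (retractPoint i (s i))) := by
  obtain ⟨s, x, hs, hx, hst, hedge⟩ := h
  obtain rfl : x = fun i => splitPoint (retractPoint i (s i)) :=
    funext fun i => (isFermatPoint_iff_eq (hT.one_third_lt hs i)).1 (hx i)
  exact ⟨s, hs, hst.trans (splitPoint_image_union_range_eq T s), hedge⟩

/-- The neighbor s_i is determined by the neighbor set of the leaf e_i, and the points x_i by
uniqueness of the Fermat point. -/
theorem isDoubling_unique (hT : T.IsCandidateOptimal) {T₁ T₂ : SimplexSteinerTree (2 * n)}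
    (h₁ : IsDoubling T T₁) (h₂ : IsDoubling T T₂) : T₁ = T₂ := by
  obtain ⟨s, hs, hst, hedge⟩ := hT.exists_of_isDoubling h₁
  obtain ⟨s', hs', hst', hedge'⟩ := hT.exists_of_isDoubling h₂
  obtain rfl : s = s' := funext fun i => Set.singleton_injective ((hs i).2.symm.trans (hs' i).2)
  exact SteinerTree.ext (hst.trans hst'.symm)
    (SimpleGraph.edgeSet_injective (hedge.trans hedge'.symm))

/-- The doubling procedure preserves candidate-optimality. -/
theorem of_isDoubling (hT : T.IsCandidateOptimal) (hn : 3 ≤ n) {T' : SimplexSteinerTree (2 * n)}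
    (h : IsDoubling T T') : T'.IsCandidateOptimal := by
  obtain ⟨s, hs, hst, hedge⟩ := hT.exists_of_isDoubling h
  have hinj := hT.injOn_doublePoint hn hs
  have hadj : ∀ u v, T'.graph.Adj u v ↔
      (∃ p q, T.graph.Adj p q ∧ u = doublePoint s p ∧ v = doublePoint s q) ∨
        IsLeafEdge s u v ∨ IsLeafEdge s v u := fun u v => by
    rw [← mem_doubledEdges_iff hs, ← hedge, SimpleGraph.mem_edgeSet]
  have hterm : ∀ j v, T'.graph.Adj (basisVec j) v →
      ∃ i, v = doublePoint s (basisVec i) ∧ (j = leftIdx i ∨ j = rightIdx i) := by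
    intro j v hv
    rcases (hadj _ _).1 hv with ⟨p, q, -, hp, -⟩ | ⟨i, rfl, hi⟩ | ⟨i, hi, -⟩
    · exact (basisVec_ne_splitPoint _ _ hp).elim
    · exact ⟨i, rfl, hi.imp (fun h => basisVec_injective h) (fun h => basisVec_injective h)⟩
    · exact (basisVec_ne_splitPoint _ _ hi).elim
  have hsteiner : ∀ z ∈ T.steiner, T'.graph.neighborSet (doublePoint s z) =
      doublePoint s '' T.graph.neighborSet z := by
    intro z hz
    ext v
    rw [SimpleGraph.mem_neighborSet, hadj]
    constructor
    · rintro (⟨p, q, hpq, hp, rfl⟩ | ⟨i, -, hi | hi⟩ | ⟨i, hi, -⟩)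
      · obtain rfl := hinj (Or.inr hz) (T.mem_of_adj _ _ hpq) hp
        exact ⟨q, hpq, rfl⟩
      · exact (basisVec_ne_splitPoint _ _ hi.symm).elim
      · exact (basisVec_ne_splitPoint _ _ hi.symm).elim
      · have := hinj (Or.inr hz) (Or.inl (basisVec_mem i)) hi
        exact (notMem_of_mem_steiner hz (this ▸ basisVec_mem i)).elim
    · rintro ⟨q, hq, rfl⟩
      exact Or.inl ⟨z, q, hq, rfl, rfl⟩
  have hfermat : ∀ i, T'.graph.neighborSet (doublePoint s (basisVec i)) =
      {basisVec (leftIdx i), basisVec (rightIdx i), splitPoint (s i)} := by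
    intro i
    have hsi : doublePoint s (s i) = splitPoint (s i) :=
      doublePoint_of_notMem s (notMem_of_mem_steiner (hs i).1)
    ext v
    rw [SimpleGraph.mem_neighborSet, hadj]
    constructor
    · rintro (⟨p, q, hpq, hp, rfl⟩ | ⟨j, -, hj | hj⟩ | ⟨j, hj, hv⟩)
      · obtain rfl := hinj (Or.inl (basisVec_mem i)) (T.mem_of_adj _ _ hpq) hp
        have : q ∈ T.graph.neighborSet (basisVec i) := hpq
        rw [(hs i).2] at this
        rw [Set.mem_singleton_iff.1 this, hsi]
        simp
      · exact (basisVec_ne_splitPoint _ _ hj.symm).elim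
      · exact (basisVec_ne_splitPoint _ _ hj.symm).elim
      · obtain rfl := basisVec_injective
          (hinj (Or.inl (basisVec_mem i)) (Or.inl (basisVec_mem j)) hj)
        rcases hv with rfl | rfl <;> simp
    · rintro (rfl | rfl | rfl)
      · exact Or.inr (Or.inr ⟨i, rfl, Or.inl rfl⟩)
      · exact Or.inr (Or.inr ⟨i, rfl, Or.inr rfl⟩)
      · have : s i ∈ T.graph.neighborSet (basisVec i) := by rw [(hs i).2]; rfl
        exact Or.inl ⟨basisVec i, s i, this, rfl, hsi.symm⟩
  constructor
  · intro u v w hu hw huw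
    rw [two_pi_div_three_le_angle_iff]
    -- A terminal has only one neighbor, so no angle arises there; at a Fermat point all angles are
    -- 120°, and at the split of a Steiner point they are inherited.
    rcases T'.mem_of_adj _ _ hu with ⟨j, rfl⟩ | hv
    · obtain ⟨i, rfl, hi⟩ := hterm j u hu
      obtain ⟨k, rfl, hk⟩ := hterm j w hw
      refine (huw ?_).elim
      rcases hi with rfl | rfl <;> rcases hk with hk | hk
      · rw [leftIdx_injective hk]
      · exact (leftIdx_ne_rightIdx _ _ hk).elim
      · exact (leftIdx_ne_rightIdx _ _ hk.symm).elim
      · rw [rightIdx_injective hk]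
    · rw [hst] at hv
      obtain ⟨z, hz | hz, rfl⟩ := hv
      · obtain ⟨i, rfl⟩ := hz
        rw [← SimpleGraph.mem_neighborSet, hfermat] at hu hw
        rw [doublePoint_basisVec]
        have h3 := hT.one_third_lt hs i
        exact inner_direction_le_of_mem (basisVec_ne_splitPoint _ _) (basisVec_ne_splitPoint _ _)
          (splitPoint_injective.ne (retractPoint_ne h3).symm)
          (direction_splitPoint_retractPoint h3) hu hw huw
      · rw [← SimpleGraph.mem_neighborSet, hsteiner z hz] at hu hw
        obtain ⟨p, hp, rfl⟩ := hu
        obtain ⟨q, hq, rfl⟩ := hw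
        exact hT.inner_direction_doublePoint_le hs hz hp hq fun h => huw (by rw [h])
  · intro z' hz'
    rw [hst] at hz'
    obtain ⟨z, hz | hz, rfl⟩ := hz'
    · obtain ⟨i, rfl⟩ := hz
      rw [hfermat, Set.ncard_eq_three]
      exact ⟨_, _, _, basisVec_injective.ne (leftIdx_ne_rightIdx i i), basisVec_ne_splitPoint _ _,
        basisVec_ne_splitPoint _ _, rfl⟩
    · have hsub : T.graph.neighborSet z ⊆ simplexVertices n ∪ T.steiner :=
        fun x hx => mem_of_adj_right hx
      rw [hsteiner z hz, (hinj.mono hsub).ncard_image, hT.2 z hz]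

end IsCandidateOptimal

end SteinerTree

/-! ### Iterating the doubling procedure. -/

section Iterate

variable {d : ℕ} {T : SimplexSteinerTree d}

theorem IteratedDoubling.eq_pow_mul {k n : ℕ} {T' : SimplexSteinerTree n}
    (h : IteratedDoubling T k n T') : n = 2 ^ k * d := by
  induction h with
  | zero => simp
  | succ _ _ ih => rw [ih, pow_succ]; ring

theorem IteratedDoubling.isCandidateOptimal (hd : 3 ≤ d) (hT : T.IsCandidateOptimal) {k n : ℕ}
    {T' : SimplexSteinerTree n} (h : IteratedDoubling T k n T') :
    3 ≤ n ∧ T'.IsCandidateOptimal := by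
  induction h with
  | zero => exact ⟨hd, hT⟩
  | succ _ h' ih => exact ⟨by omega, ih.2.of_isDoubling ih.1 h'⟩

theorem exists_iteratedDoubling (hd : 3 ≤ d) (hT : T.IsCandidateOptimal) (k : ℕ) :
    ∃ (n : ℕ) (T' : SimplexSteinerTree n), IteratedDoubling T k n T' := by
  induction k with
  | zero => exact ⟨d, T, .zero⟩
  | succ k ih =>
    obtain ⟨n, T₁, h⟩ := ih
    obtain ⟨hn, hT₁⟩ := h.isCandidateOptimal hd hT
    obtain ⟨T₂, h₂⟩ := hT₁.exists_isDoubling hn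
    exact ⟨2 * n, T₂, h.succ h₂⟩

/-- The dimension is an index of the predicate, and those of two runs agree only through
`eq_pow_mul`; hence the heterogeneous equality. -/
theorem IteratedDoubling.heq (hd : 3 ≤ d) (hT : T.IsCandidateOptimal) {k n : ℕ}
    {T₁ : SimplexSteinerTree n} (h₁ : IteratedDoubling T k n T₁) :
    ∀ {m : ℕ} {T₂ : SimplexSteinerTree m}, IteratedDoubling T k m T₂ → HEq T₁ T₂ := by
  induction h₁ with
  | zero =>
    intro m T₂ h₂
    cases h₂
    rfl
  | succ h hD ih =>
    intro m T₂ h₂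
    cases h₂ with
    | succ h' hD' =>
      obtain rfl := h.eq_pow_mul.trans h'.eq_pow_mul.symm
      obtain rfl := eq_of_heq (ih h')
      exact heq_of_eq ((h.isCandidateOptimal hd hT).2.isDoubling_unique hD hD')

end Iterate

theorem mainTheorem9 (d : ℕ) (hd : 3 ≤ d) (k : ℕ) (T : SimplexSteinerTree d)
    (hT : T.IsOptimal) :
    (∃! T' : SimplexSteinerTree (2 ^ k * d), IteratedDoubling T k (2 ^ k * d) T') ∧
      ∀ T' : SimplexSteinerTree (2 ^ k * d), IteratedDoubling T k (2 ^ k * d) T' →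
        T'.IsFull ∧ T'.IsCandidateOptimal := by
  have hc := hT.isCandidateOptimal (simplexVertices_nonempty hd)
  refine ⟨?_, fun T' h => ?_⟩
  · obtain ⟨n, T', h⟩ := exists_iteratedDoubling hd hc k
    obtain rfl := h.eq_pow_mul
    exact ⟨T', h, fun T'' h'' => eq_of_heq (h''.heq hd hc h)⟩
  · obtain ⟨hn, h'⟩ := h.isCandidateOptimal hd hc
    exact ⟨h'.isFull hn, h'⟩
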